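/- In the (randomized, synchronous) CONGEST model, consider a connected simple undirected unweighted network $G=(V,E)$ with $n\ge 1$ vertices, diameter $D$ and girth $g$ ($g=\infty$ if $G$ has no cycle). Vertices have distinct $O(\log n)$-bit identifiers; every vertex initially knows $n$, its own identifier and a common constant-factor approximation of $D$, has private independent random bits, and sends in each round at most $O(\log n)$ bits along each incident edge. For every integer $f\ge 1$ and real $c\ge 1$ there is a randomized CONGEST algorithm that on every such network always terminates within $\tilde O(c\, f\, n^{1/f}+fD)$ rounds (so within $\tilde O(f\, n^{1/f}+fD)$ rounds for constant $c$; $\tilde O$ hides a factor polylogarithmic in $n$, and the implied constants do not depend on $f$, $c$ or the network), after which all vertices know a common value $M\in\mathbb N\cup\{\infty\}$, such that $$g\le M\le f\cdot g\qquad\text{with probability at least } 1-n^{-c}.$$ Moreover the value $M$ is obtained as follows. For $S\subseteq V$ and $k\in\mathbb N$ let $U(S,k,v)$ be the set of the $k$ vertices of $S$ closest to $v$ (ties broken by smaller identifier; $U(S,k,v)=S$ if $|S|\le k$). A result of $\mathrm{Estimate}(S,k)$ is a value $$\min\{\,d(s,x)+d(s,y)+1 \;:\; \{x,y\}\in E,\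 s\in U(S,k,x)\cap U(S,k,y),\ p(s,x)\ne y,\ p(s,y)\ne x\,\}$$ (with $\min\emptyset=\infty$), where $p$ are parent pointers of partial BFS trees: for $s\in U(S,k,v)$, $s\neq v$, the vertex $p(s,v)$ is a neighbour of $v$ with $d(s,p(s,v))=d(s,v)-1$, and $s$ itself has no parent in its tree. If $n\le f$, then $M$ is a result of $\mathrm{Estimate}(V,n)$. If $n>f$, then $M=\min(M_0,\dots,M_{f-1})$, where $M_i$ is a result of $\mathrm{Estimate}(A_i,k)$ with $k=\lceil 12(c+3)n^{1/f}\log_2 n\rceil$, $A_0=V$, and, for $1\le i\le f-1$, the set $A_i$ contains each vertex independently with probability $p_i=\min\big((c+3)n^{-i/f}\log_2 n,\,1\big)$. -/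

import Mathlib

open MeasureTheory ProbabilityTheory

/-! ### Communication networks -/

/-- A communication network: a connected simple graph on the vertex set `V`, distinct numerical
identifiers, and at every vertex `v` an arbitrary numbering `0, …, deg v - 1` of its incident edges
(its ports); `port v j` is the neighbour of `v` behind port `j`. -/
structure Network (V : Type) where
  graph : SimpleGraph V
  connected : graph.Connected
  ident : V → ℕ
  ident_injective : Function.Injective ident
  deg : V → ℕ
  port : (v : V) → Fin (deg v) ≃ graph.neighborSet v

/-! ### The randomized CONGEST model -/

/-- What a vertex knows before the first round: the number of vertices, an approximation of the
diameter of the network, its own identifier, its degree, and its private random bits. -/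
structure LocalInput where
  size : ℕ
  diamApprox : ℕ
  ident : ℕ
  degree : ℕ
  coins : ℕ → Bool

/-- A randomized distributed algorithm in which every vertex finally returns an element of `ℕ∞`.
All vertices run the same code, and local computation is free. In each round a vertex sends one bit
string through each of its ports (`send s j` is sent through port `j` in state `s`), receives one
bit string from each port, and updates its state with `receive`.
A vertex terminates with result `m` when it reaches a state `s` with `output s = some m`. -/
structure CongestAlgorithm where
  State : Type
  start : LocalInput → State
  send : State → ℕ → List Bool
  receive : State → (ℕ → List Bool) → State
  output : State → Option ℕ∞

namespace CongestAlgorithm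

/-- The bit string sent through port `j` by a vertex in state `s`. Terminated vertices are silent,
which is represented by the empty string. -/
def message (A : CongestAlgorithm) (s : A.State) (j : ℕ) : List Bool :=
  if (A.output s).isSome then [] else A.send s j

/-- The bit strings received by `v` in a round, by ports, when `σ` gives the current states. -/
def inbox (A : CongestAlgorithm) {V : Type} (N : Network V) (σ : V → A.State) (v : V) (j : ℕ) :
    List Bool :=
  if h : j < N.deg v then
    A.message (σ (N.port v ⟨j, h⟩))
      ((N.port (N.port v ⟨j, h⟩)).symm ⟨v, (N.port v ⟨j, h⟩).2.symm⟩)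
  else []

/-- The state of each vertex after `t` synchronous rounds on the network `N`, where `Dapx` is the
approximation of the diameter given to the vertices and `ω v` are the random bits of `v`.
The state of a terminated vertex does not change any more. -/
def stateAfter (A : CongestAlgorithm) {V : Type} [Fintype V] (N : Network V) (Dapx : ℕ)
    (ω : V → ℕ → Bool) : ℕ → V → A.State
  | 0, v => A.start
      { size := Fintype.card V
        diamApprox := Dapx
        ident := N.ident v
        degree := N.deg v
        coins := ω v }
  | t + 1, v =>
      if (A.output (A.stateAfter N Dapx ω t v)).isSome then A.stateAfter N Dapx ω t v
      else A.receive (A.stateAfter N Dapx ω t v) (A.inbox N (A.stateAfter N Dapx ω t) v)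

end CongestAlgorithm

/-- The law of an infinite sequence of independent fair bits. -/
noncomputable def coinLaw : Measure (ℕ → Bool) :=
  Measure.infinitePi fun _ => (PMF.uniformOfFintype Bool).toMeasure

/-- The law of the random bits of all vertices: each vertex has its own independent sequence. -/
noncomputable def networkCoinLaw (V : Type) [Fintype V] : Measure (V → ℕ → Bool) :=
  Measure.pi fun _ => coinLaw

/-! ### The estimation procedure -/

namespace Network

variable {V : Type}

/-- `N.Closer u v w`: the vertex `v` is closer to `u` than `w`, ties being broken by
identifiers. -/
def Closer (N : Network V) (u v w : V) : Prop :=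
  N.graph.dist u v < N.graph.dist u w ∨
    (N.graph.dist u v = N.graph.dist u w ∧ N.ident v < N.ident w)

/-- The set of the `k` vertices of `S` closest to `v` (all of `S` if `S` has at most `k`
elements): those `s ∈ S` such that fewer than `k` elements of `S` are closer to `v` than `s`. -/
def closest (N : Network V) (S : Set V) (k : ℕ) (v : V) : Set V :=
  {s | s ∈ S ∧ {s' | s' ∈ S ∧ N.Closer v s' s}.ncard < k}

/-- `p s v` are the parent pointers of partial BFS trees, one rooted at each source `s ∈ S`, in
which every vertex `v` takes part in the trees of its `k` closest sources. -/
def IsPartialBFS (N : Network V) (S : Set V) (k : ℕ) (p : V → V → Option V) : Prop :=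
  ∀ v, ∀ s ∈ N.closest S k v,
    (s = v → p s v = none) ∧
    (s ≠ v → ∃ u, p s v = some u ∧ N.graph.Adj u v ∧ N.graph.dist s u + 1 = N.graph.dist s v)

/-- The minimum of `d(s,x) + d(s,y) + 1` over all edges `xy` and all sources `s` such that both
`x` and `y` are in the partial BFS tree of `s` but `xy` is not an edge of it (`⊤` if there are
none). -/
noncomputable def estimate (N : Network V) (S : Set V) (k : ℕ) (p : V → V → Option V) : ℕ∞ :=
  ⨅ (x : V) (y : V) (s : V) (_ : N.graph.Adj x y ∧ s ∈ N.closest S k x ∧ s ∈ N.closest S k y ∧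
    p s x ≠ some y ∧ p s y ≠ some x), ((N.graph.dist s x + N.graph.dist s y + 1 : ℕ) : ℕ∞)

/-- `M` is a possible result of the estimation procedure for `S` and `k`: the estimate computed
from some partial BFS trees. -/
def IsEstimate (N : Network V) (S : Set V) (k : ℕ) (M : ℕ∞) : Prop :=
  ∃ p, N.IsPartialBFS S k p ∧ M = N.estimate S k p

end Network

/-! ### The approximation scheme -/

/-- The sampling probability `min ((c + 3) n^{-i/f} log₂ n, 1)` of the scale `i`. -/
noncomputable def sampleProb (f : ℕ) (c : ℝ) (n i : ℕ) : ℝ :=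
  min ((c + 3) * (n : ℝ) ^ (-(i : ℝ) / (f : ℝ)) * Real.logb 2 n) 1

/-- The number `⌈12 (c + 3) n^{1/f} log₂ n⌉` of closest sources used in each estimation. -/
noncomputable def sourceCount (f : ℕ) (c : ℝ) (n : ℕ) : ℕ :=
  ⌈12 * (c + 3) * (n : ℝ) ^ (1 / (f : ℝ)) * Real.logb 2 n⌉₊

/-- `E i` is, for each scale `i`, the event (in terms of its own random bits) that a vertex of an
`n`-vertex network samples itself: these events are independent with the right probabilities. -/
def IsSampling (f : ℕ) (c : ℝ) (n : ℕ) (E : ℕ → Set (ℕ → Bool)) : Prop :=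
  (∀ i, MeasurableSet (E i)) ∧ iIndepSet E coinLaw ∧
    ∀ i, coinLaw (E i) = ENNReal.ofReal (sampleProb f c n i)

/-- `M` is a possible result of the multi-scale scheme with sampled sets `A 1, …, A (f - 1)`:
if `n ≤ f`, a result of the estimation procedure for all vertices as sources and `k = n`;
otherwise the minimum of results of the `f` estimations with `k = sourceCount f c n`, for the
source sets `V, A 1, …, A (f - 1)`. -/
def IsMultiScaleEstimate {V : Type} [Fintype V] (N : Network V) (f : ℕ) (c : ℝ)
    (A : ℕ → Set V) (M : ℕ∞) : Prop :=
  if Fintype.card V ≤ f then N.IsEstimate Set.univ (Fintype.card V) M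
  else ∃ m : Fin f → ℕ∞,
    (∀ i : Fin f, N.IsEstimate (if (i : ℕ) = 0 then Set.univ else A i)
      (sourceCount f c (Fintype.card V)) (m i)) ∧
    M = ⨅ i, m i

/-! ### Events of prescribed probability in sequences of fair bits -/

/-! No estimate is below the girth: if the edge xy lies outside the tree of s, then either x and y
are equally far from s, or the farther endpoint has two neighbours one step nearer to s. Both cases
give two different paths from s to one vertex, of total length d(s,x) + d(s,y) + 1
(`IsPartialBFS.egirth_le_estimate`).

For the upper bound take a shortest cycle C, of length g. If s is among the k closest sources of
every vertex of C, the estimate is at most 2 d(s,z) + g for each z on C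
(`IsPartialBFS.estimate_le_of_isCycle`). Sources are found by climbing the scales, starting with s
on C. Suppose s is a source of scale i at distance at most i g / 2 from C. If every vertex of C has
at most n^{(i+1)/f} vertices closer than s, then fewer than k of these are sampled, and M_i ≤ (i +
1) g ≤ f g. Otherwise some u on C has more closer vertices, one of them is sampled at scale i + 1,
and it lies within (i + 1) g / 2 of u. At scale f - 1 the second case is impossible, as n^{f/f} = n
(`le_mul_length_of_isCycle`). Product and exponential moment bounds with a union bound over scales
and pairs (u, s) control the failure probability (`measure_not_approx_le`).

The distributed part is pipelined source detection: a vertex announces in round r the source whose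
distance and position in its table add up to r. One step towards s the distance drops by one and the
position does not grow, so the news always arrives in time (`IsDetection.knownTable_eq`), and D + k
rounds suffice for the k closest sources. Each vertex then evaluates its own edges, and the minimum
is flooded (`IsFlooding.floodValue_eq`). -/

instance : IsProbabilityMeasure coinLaw := by unfold coinLaw; infer_instance

/-- The set of bit sequences whose first `true` is at position `j`. -/
def firstTrueAt (j : ℕ) : Set (ℕ → Bool) :=
  Set.pi (Finset.range (j + 1)) fun i => {decide (i = j)}

theorem mem_firstTrueAt {j : ℕ} {x : ℕ → Bool} :
    x ∈ firstTrueAt j ↔ ∀ i ≤ j, x i = decide (i = j) := by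
  simp [firstTrueAt, Set.mem_pi]

theorem measurableSet_firstTrueAt (j : ℕ) : MeasurableSet (firstTrueAt j) :=
  MeasurableSet.pi (Finset.countable_toSet _) fun _ _ => measurableSet_singleton _

theorem coinLaw_firstTrueAt (j : ℕ) : coinLaw (firstTrueAt j) = (2⁻¹ : ENNReal) ^ (j + 1) := by
  rw [coinLaw, firstTrueAt, Measure.infinitePi_pi _ fun _ _ => measurableSet_singleton _]
  simp [PMF.uniformOfFintype_apply, em]

theorem disjoint_firstTrueAt : Pairwise (Function.onFun Disjoint firstTrueAt) := by
  intro i j hij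
  refine Set.disjoint_left.2 fun x hi hj => ?_
  rw [mem_firstTrueAt] at hi hj
  rcases lt_or_gt_of_ne hij with h | h
  · have h1 := hi i le_rfl
    have h2 := hj i h.le
    simp [h1, hij] at h2
  · have h1 := hj j le_rfl
    have h2 := hi j h.le
    simp [h1, hij.symm] at h2

/-- The first `true` is at position j with probability 2^{-(j+1)}; collecting the positions where
the binary expansion of p has digit 1 gives total mass p. The value p = 1 has no such expansion. -/
theorem exists_coinLaw_eq {p : ℝ} (h0 : 0 ≤ p) (h1 : p ≤ 1) :
    ∃ F : Set (ℕ → Bool), MeasurableSet F ∧ coinLaw F = ENNReal.ofReal p := by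
  rcases h1.eq_or_lt with rfl | h1
  · exact ⟨Set.univ, MeasurableSet.univ, by simp⟩
  have hs := Real.hasSum_ofDigitsTerm_digits p (b := 2) one_lt_two ⟨h0, h1⟩
  have hp : ENNReal.ofReal p = ∑' j, ENNReal.ofReal (Real.ofDigitsTerm (Real.digits p 2) j) := by
    rw [← ENNReal.ofReal_tsum_of_nonneg (fun _ => Real.ofDigitsTerm_nonneg) hs.summable, hs.tsum_eq]
  refine ⟨⋃ j ∈ {j | Real.digits p 2 j = 1}, firstTrueAt j,
    MeasurableSet.biUnion (Set.to_countable _) fun j _ => measurableSet_firstTrueAt j, ?_⟩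
  rw [measure_biUnion (Set.to_countable _) (fun i _ j _ hij => disjoint_firstTrueAt hij)
    fun j _ => measurableSet_firstTrueAt j, hp,
    tsum_subtype {j | Real.digits p 2 j = 1} fun j => coinLaw (firstTrueAt j)]
  refine tsum_congr fun j => ?_
  have hd : Real.digits p 2 j = 0 ∨ Real.digits p 2 j = 1 := by omega
  rcases hd with hd | hd
  · simp [Real.ofDigitsTerm, hd, Set.indicator]
  · simp only [Set.indicator, Set.mem_ofPred_eq, hd, if_true, coinLaw_firstTrueAt, Real.ofDigitsTerm]
    rw [← inv_pow]
    simp [ENNReal.ofReal_pow, ENNReal.ofReal_inv_of_pos, ENNReal.inv_pow]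

/-- The `i`-th row of a bit sequence that is arranged as a two-dimensional array. -/
def coinRow (i : ℕ) (x : ℕ → Bool) (j : ℕ) : Bool := x (Nat.pair i j)

theorem measurable_coinRow (i : ℕ) : Measurable (coinRow i) := by
  unfold coinRow; fun_prop

theorem map_coinRow (i : ℕ) : coinLaw.map (coinRow i) = coinLaw :=
  Measure.map_infinitePi_infinitePi_of_inj (f := fun j => Nat.pair i j)
    (P := fun _ : ℕ => (PMF.uniformOfFintype Bool).toMeasure)
    fun _ _ h => (Nat.pair_eq_pair.1 h).2

/-- Reindexing along the injection `Nat.pair` and currying turn one sequence of fair bits into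
independent sequences, one for each scale. -/
theorem iIndepFun_coinRow : iIndepFun coinRow coinLaw := by
  rw [iIndepFun_iff_map_fun_eq_infinitePi_map measurable_coinRow]
  simp_rw [map_coinRow]
  have h1 : coinLaw.map (fun (x : ℕ → Bool) (q : ℕ × ℕ) => x (Nat.pair q.1 q.2)) =
      Measure.infinitePi fun _ => (PMF.uniformOfFintype Bool).toMeasure :=
    Measure.map_infinitePi_infinitePi_of_inj (f := fun q : ℕ × ℕ => Nat.pair q.1 q.2)
      (P := fun _ : ℕ => (PMF.uniformOfFintype Bool).toMeasure)
      fun _ _ h => Prod.ext_iff.2 (Nat.pair_eq_pair.1 h)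
  have h2 := Measure.infinitePi_map_curry
    fun _ _ : ℕ => (PMF.uniformOfFintype Bool).toMeasure
  rw [← h1, Measure.map_map (by fun_prop) (by fun_prop)] at h2
  exact h2

theorem exists_isSampling (f : ℕ) {c : ℝ} (hc : 0 ≤ c + 3) (n : ℕ) :
    ∃ E, IsSampling f c n E := by
  have h (i : ℕ) : 0 ≤ sampleProb f c n i := by
    have : 0 ≤ Real.logb 2 n := by
      rcases n.eq_zero_or_pos with rfl | hn
      · simp
      · exact Real.logb_nonneg one_lt_two (by exact_mod_cast hn)
    unfold sampleProb
    positivity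
  choose F hF hFp using fun i => exists_coinLaw_eq (h i) (min_le_right _ _)
  refine ⟨fun i => coinRow i ⁻¹' F i, fun i => measurable_coinRow i (hF i), ?_, fun i => ?_⟩
  · rw [iIndepSet_iff_meas_biInter fun i => measurable_coinRow i (hF i)]
    exact fun s => iIndepFun_coinRow.measure_inter_preimage_eq_mul s fun i _ => hF i
  · rw [← Measure.map_apply (measurable_coinRow i) (hF i), map_coinRow, hFp]

/-! ### Partial BFS trees and the girth -/

namespace Network

variable {V : Type}

theorem egirth_le_of_isPath_ne {G : SimpleGraph V} {u v : V} {p q : G.Walk u v}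
    (hp : p.IsPath) (hq : q.IsPath) (h : p ≠ q) : G.egirth ≤ (p.length + q.length : ℕ) := by
  obtain ⟨w, -, -, c, hc, hl⟩ := hp.exists_isCycle_length_le_add_of_ne hq h
  exact (SimpleGraph.egirth_le_length hc).trans (by exact_mod_cast hl)

/-- Two distinct neighbours `y`, `u` of `x`, one step closer to `s`, close a cycle. -/
theorem egirth_le_of_two_parents {G : SimpleGraph V} (hG : G.Connected) {s x y u : V}
    (hyx : G.Adj y x) (hux : G.Adj u x) (hne : u ≠ y) (hy : G.dist s y + 1 = G.dist s x)
    (hu : G.dist s u + 1 = G.dist s x) : G.egirth ≤ (G.dist s x + G.dist s x : ℕ) := by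
  obtain ⟨p, hp⟩ := hG.exists_walk_length_eq_dist s y
  obtain ⟨q, hq⟩ := hG.exists_walk_length_eq_dist s u
  have hp' : (p.concat hyx).length = G.dist s x := by simp [hp, hy]
  have hq' : (q.concat hux).length = G.dist s x := by simp [hq, hu]
  have := egirth_le_of_isPath_ne ((p.concat hyx).isPath_of_length_eq_dist hp')
    ((q.concat hux).isPath_of_length_eq_dist hq') fun h => hne (by
      simpa using (congrArg SimpleGraph.Walk.penultimate h).symm)
  rwa [hp', hq'] at this

/-- An edge between two vertices at the same distance from `s` closes an odd cycle. -/
theorem egirth_le_of_dist_eq {G : SimpleGraph V} (hG : G.Connected) {s x y : V}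
    (hyx : G.Adj y x) (h : G.dist s y = G.dist s x) :
    G.egirth ≤ (G.dist s x + G.dist s y + 1 : ℕ) := by
  obtain ⟨p, hp⟩ := hG.exists_walk_length_eq_dist s y
  obtain ⟨q, hq⟩ := hG.exists_walk_length_eq_dist s x
  have hpp := p.isPath_of_length_eq_dist hp
  -- Reaching x strictly before y on a shortest path would make x nearer to s than y.
  have hx : x ∉ p.support := by
    classical
    intro hx
    have h1 := SimpleGraph.dist_le (p.takeUntil x hx)
    have h2 := p.length_takeUntil_lt_length hx hyx.ne'
    omega
  have := egirth_le_of_isPath_ne (q.isPath_of_length_eq_dist hq) (hpp.concat hx hyx) fun he => by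
    have := congrArg SimpleGraph.Walk.length he
    simp at this
    omega
  simpa [hp, hq, add_assoc] using this

variable {N : Network V} {S : Set V} {k : ℕ} {p : V → V → Option V}

theorem dist_le_dist_add_one (N : Network V) {x y : V} (s : V) (h : N.graph.Adj x y) :
    N.graph.dist s y ≤ N.graph.dist s x + 1 := by
  have h1 := N.connected.dist_triangle (u := s) (v := x) (w := y)
  rwa [SimpleGraph.dist_eq_one_iff_adj.2 h] at h1

/-- The tree parent of x and y are two distinct neighbours of x one step nearer to s, and 2 d(s,x) =
d(s,x) + d(s,y) + 1. -/
theorem IsPartialBFS.egirth_le_of_dist_lt (hp : N.IsPartialBFS S k p) {x y s : V}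
    (hxy : N.graph.Adj x y) (hx : s ∈ N.closest S k x) (hpx : p s x ≠ some y)
    (hlt : N.graph.dist s y < N.graph.dist s x) :
    N.graph.egirth ≤ (N.graph.dist s x + N.graph.dist s y + 1 : ℕ) := by
  have hd : N.graph.dist s y + 1 = N.graph.dist s x := by
    have := N.dist_le_dist_add_one s hxy.symm
    omega
  have hsx : s ≠ x := by
    rintro rfl
    simp at hlt
  obtain ⟨u, hpu, hux, hu⟩ := (hp x s hx).2 hsx
  have := egirth_le_of_two_parents N.connected hxy.symm hux (fun h => hpx (by rw [hpu, h])) hd hu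
  rwa [add_assoc, hd]

theorem IsPartialBFS.egirth_le_estimate (hp : N.IsPartialBFS S k p) :
    N.graph.egirth ≤ N.estimate S k p := by
  refine le_iInf fun x => le_iInf fun y => le_iInf fun s => le_iInf fun h => ?_
  obtain ⟨hxy, hx, hy, hpx, hpy⟩ := h
  rcases lt_trichotomy (N.graph.dist s x) (N.graph.dist s y) with h | h | h
  · rw [add_comm (N.graph.dist s x)]
    exact hp.egirth_le_of_dist_lt hxy.symm hy hpy h
  · exact egirth_le_of_dist_eq N.connected hxy.symm h.symm
  · exact hp.egirth_le_of_dist_lt hxy hx hpx h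

theorem IsEstimate.egirth_le {M : ℕ∞} (h : N.IsEstimate S k M) : N.graph.egirth ≤ M := by
  obtain ⟨p, hp, rfl⟩ := h
  exact hp.egirth_le_estimate

theorem estimate_le {x y s : V} (hxy : N.graph.Adj x y) (hx : s ∈ N.closest S k x)
    (hy : s ∈ N.closest S k y) (hpx : p s x ≠ some y) (hpy : p s y ≠ some x) :
    N.estimate S k p ≤ (N.graph.dist s x + N.graph.dist s y + 1 : ℕ) :=
  iInf_le_of_le x <| iInf_le_of_le y <| iInf_le_of_le s <| iInf_le_of_le ⟨hxy, hx, hy, hpx, hpy⟩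
    le_rfl

theorem dist_getVert_le {G : SimpleGraph V} {u v : V} (c : G.Walk u v) (i j : ℕ) :
    G.dist (c.getVert i) (c.getVert (i + j)) ≤ j := by
  rw [← SimpleGraph.Walk.drop_getVert]
  exact (SimpleGraph.dist_le ((c.drop i).take j)).trans (by simp)

/-- If `s` is among the closest sources for all vertices of a cycle, then the estimate is at most
the length of the cycle plus twice the distance of `s` to any of its vertices. -/
theorem IsPartialBFS.estimate_le_of_isCycle (hp : N.IsPartialBFS S k p) {w z s : V}
    {c : N.graph.Walk w w} (hc : c.IsCycle) (hs : ∀ u ∈ c.support, s ∈ N.closest S k u)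
    (hz : z ∈ c.support) :
    N.estimate S k p ≤ (2 * N.graph.dist s z + c.length : ℕ) := by
  classical
  -- Let x be a vertex of the cycle farthest from s. At most one of its two cycle neighbours is its
  -- parent, and by maximality x is the parent of neither; the other neighbour therefore gives an
  -- admissible edge.
  obtain ⟨x, hxc, hmax⟩ := c.support.toFinset.exists_max_image (fun u => N.graph.dist s u)
    ⟨w, by simp⟩
  simp only [List.mem_toFinset] at hxc hmax
  obtain ⟨b, hb, hbs, hbl⟩ : ∃ b : N.graph.Walk x x, b.IsCycle ∧
      (∀ u, u ∈ b.support ↔ u ∈ c.support) ∧ b.length = c.length :=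
    ⟨c.rotate x hxc, hc.rotate hxc, fun u => by
      rw [SimpleGraph.Walk.mem_support_rotate_iff], by simp⟩
  have hnil := hb.not_nil
  have h3 := hb.three_le_length
  have hadj1 := b.adj_snd hnil
  have hadj2 := (b.adj_penultimate hnil).symm
  have key : ∀ y ∈ b.support, N.graph.Adj x y → p s x ≠ some y →
      N.estimate S k p ≤ (N.graph.dist s x + N.graph.dist s y + 1 : ℕ) := by
    intro y hy hxy hpx
    have hsy := hs y ((hbs y).1 hy)
    refine estimate_le hxy (hs x hxc) hsy hpx fun hpy => ?_
    by_cases hse : s = y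
    · rw [(hp y s hsy).1 hse] at hpy
      cases hpy
    obtain ⟨u, hpu, -, hu⟩ := (hp y s hsy).2 hse
    rw [hpu, Option.some.injEq] at hpy
    subst hpy
    have := hmax y ((hbs y).1 hy)
    omega
  -- The cycle consists of the chosen edge xy and two arcs, from z to x and from z to y. Hence
  -- d(z,x) + d(z,y) + 1 is at most its length.
  obtain ⟨j, hj, hjl⟩ := SimpleGraph.Walk.mem_support_iff_exists_getVert.1 ((hbs z).2 hz)
  have tri := fun a => N.connected.dist_triangle (u := s) (v := z) (w := a)
  have d1 := dist_getVert_le b j (b.length - j)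
  have d2 := dist_getVert_le b 0 j
  rw [add_tsub_cancel_of_le hjl, b.getVert_length] at d1
  rw [zero_add, b.getVert_zero, N.graph.dist_comm] at d2
  rw [hj] at d1 d2
  have t := tri x
  rcases eq_or_ne (p s x) (some b.snd) with hpx | hpx
  · have hpx' : p s x ≠ some b.penultimate := by
      rw [hpx]
      exact fun h => hb.snd_ne_penultimate (Option.some_injective _ h)
    refine (key b.penultimate (b.getVert_mem_support _) hadj2 hpx').trans ?_
    have t' := tri b.penultimate
    norm_cast
    -- At j = `b.length` the vertex z is x and one arc degenerates; there `3 ≤ b.length` is enough.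
    rcases hjl.eq_or_lt with rfl | hjl
    · have hzx : z = x := by rw [← hj, b.getVert_length]
      have : N.graph.dist z b.penultimate = 1 := by
        rw [hzx]; exact SimpleGraph.dist_eq_one_iff_adj.2 hadj2
      rw [hzx] at t this ⊢
      rw [hzx] at t'
      omega
    · have d3 := dist_getVert_le b j (b.length - 1 - j)
      rw [show j + (b.length - 1 - j) = b.length - 1 by omega, hj] at d3
      change N.graph.dist z b.penultimate ≤ _ at d3
      omega
  · refine (key b.snd (b.getVert_mem_support _) hadj1 hpx).trans ?_
    have t' := tri b.snd
    norm_cast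
    rcases Nat.eq_zero_or_pos j with rfl | hj0
    · have hzx : z = x := by rw [← hj, b.getVert_zero]
      have : N.graph.dist z b.snd = 1 := by
        rw [hzx]; exact SimpleGraph.dist_eq_one_iff_adj.2 hadj1
      rw [hzx] at t this ⊢
      rw [hzx] at t'
      omega
    · have d3 := dist_getVert_le b 1 (j - 1)
      rw [show 1 + (j - 1) = j by omega, hj, N.graph.dist_comm] at d3
      change N.graph.dist z b.snd ≤ _ at d3
      omega

/-- The shorter of the two arcs between u and z has at most half the total length. -/
theorem two_mul_dist_le_of_isCycle {G : SimpleGraph V} {w u z : V} {c : G.Walk w w}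
    (hu : u ∈ c.support) (hz : z ∈ c.support) : 2 * G.dist u z ≤ c.length := by
  classical
  obtain ⟨b, hbs, hbl⟩ : ∃ b : G.Walk u u, (z ∈ b.support ↔ z ∈ c.support) ∧ b.length = c.length :=
    ⟨c.rotate u hu, by rw [SimpleGraph.Walk.mem_support_rotate_iff], by simp⟩
  obtain ⟨j, hj, hjl⟩ := SimpleGraph.Walk.mem_support_iff_exists_getVert.1 (hbs.2 hz)
  have d1 := dist_getVert_le b j (b.length - j)
  have d2 := dist_getVert_le b 0 j
  rw [add_tsub_cancel_of_le hjl, b.getVert_length, G.dist_comm] at d1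
  rw [zero_add, b.getVert_zero] at d2
  rw [hj] at d1 d2
  omega

end Network

/-! ### The approximation guarantee of the multi-scale scheme -/

namespace Network

variable {V : Type} {N : Network V}

/-- The set of the vertices that are closer to `u` than `s`. -/
def closerSet (N : Network V) (u s : V) : Set V := {w | N.Closer u w s}

theorem dist_le_of_mem_closerSet {u s w : V} (h : w ∈ N.closerSet u s) :
    N.graph.dist u w ≤ N.graph.dist u s := by
  rcases h with h | h
  · exact h.le
  · exact h.1.le

theorem IsEstimate.le_of_isCycle {S : Set V} {k : ℕ} {M : ℕ∞} (h : N.IsEstimate S k M) {w z s : V}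
    {C : N.graph.Walk w w} (hC : C.IsCycle) (hs : ∀ u ∈ C.support, s ∈ N.closest S k u)
    (hz : z ∈ C.support) : M ≤ (2 * N.graph.dist s z + C.length : ℕ) := by
  obtain ⟨p, hp, rfl⟩ := h
  exact hp.estimate_le_of_isCycle hC hs hz

variable [Fintype V]

theorem ncard_closerSet_lt (u s : V) : (N.closerSet u s).ncard < Fintype.card V := by
  rw [← Nat.card_eq_fintype_card, ← Set.ncard_univ]
  refine Set.ncard_lt_ncard ((Set.ssubset_univ_iff).2 fun h => ?_)
  have : s ∈ N.closerSet u s := h ▸ Set.mem_univ s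
  simp [closerSet, Closer] at this

/-- The properties of the sampled set `A` of the scale `i` that the analysis uses: big sets of
closer vertices are hit, and small ones contain few sampled vertices. -/
def IsGoodSample (N : Network V) (f : ℕ) (c : ℝ) (i : ℕ) (A : Set V) : Prop :=
  ∀ u s : V,
    ((Fintype.card V : ℝ) ^ ((i : ℝ) / f) ≤ (N.closerSet u s).ncard →
      ∃ w ∈ N.closerSet u s, w ∈ A) ∧
    ((N.closerSet u s).ncard ≤ (Fintype.card V : ℝ) ^ (((i : ℝ) + 1) / f) →
      (N.closerSet u s ∩ A).ncard < sourceCount f c (Fintype.card V))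

theorem one_le_logb {n : ℕ} (hn : 2 ≤ n) : 1 ≤ Real.logb 2 n := by
  rw [Real.le_logb_iff_rpow_le one_lt_two (by positivity)]
  simpa using (by exact_mod_cast hn : (2 : ℝ) ≤ n)

/-- Serves scale 0, where every vertex is a source and the bound n^{1/f} on the closer vertices
themselves has to stay below k. -/
theorem rpow_lt_sourceCount {f n : ℕ} {c : ℝ} (hc : 1 ≤ c) (hn : 2 ≤ n) :
    (n : ℝ) ^ (1 / (f : ℝ)) < sourceCount f c n := by
  refine lt_of_lt_of_le ?_ (Nat.le_ceil _)
  have h1 : 0 < (n : ℝ) ^ (1 / (f : ℝ)) := by positivity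
  have h2 := one_le_logb hn
  have h3 : (n : ℝ) ^ (1 / (f : ℝ)) ≤ (n : ℝ) ^ (1 / (f : ℝ)) * Real.logb 2 n :=
    le_mul_of_one_le_right h1.le h2
  nlinarith

theorem _root_.IsMultiScaleEstimate.egirth_le {f : ℕ} {c : ℝ} {A : ℕ → Set V} {M : ℕ∞}
    (h : IsMultiScaleEstimate N f c A M) : N.graph.egirth ≤ M := by
  unfold IsMultiScaleEstimate at h
  split_ifs at h
  · exact h.egirth_le
  · obtain ⟨m, hm, rfl⟩ := h
    exact le_iInf fun i => (hm i).egirth_le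

theorem le_mul_length_of_isCycle {f : ℕ} {c : ℝ} {A : ℕ → Set V} {M : ℕ∞} (hf : 1 ≤ f)
    (hc : 1 ≤ c) (h : IsMultiScaleEstimate N f c A M)
    (hA : f < Fintype.card V → ∀ i, 1 ≤ i → i < f → N.IsGoodSample f c i (A i))
    {w : V} {C : N.graph.Walk w w} (hC : C.IsCycle) : M ≤ (f * C.length : ℕ) := by
  unfold IsMultiScaleEstimate at h
  split_ifs at h with hn
  -- With k = n every vertex of the cycle is a source for the whole cycle, so the distance term
  -- vanishes.
  · have h1 := h.le_of_isCycle hC (s := w) (z := w) (fun u _ => ⟨Set.mem_univ _, by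
      simpa [closerSet] using ncard_closerSet_lt (N := N) u w⟩) (by simp)
    refine h1.trans ?_
    simp only [SimpleGraph.dist_self, mul_zero, zero_add]
    exact_mod_cast Nat.le_mul_of_pos_left _ hf
  rw [not_le] at hn
  obtain ⟨m, hm, rfl⟩ := h
  set S : ℕ → Set V := fun i => if i = 0 then Set.univ else A i with hS
  set g := C.length
  have hf0 : (0 : ℝ) < f := by exact_mod_cast hf
  have hclosest : ∀ i < f, ∀ s ∈ S i, ∀ u,
      ((N.closerSet u s).ncard : ℝ) ≤ (Fintype.card V : ℝ) ^ (((i : ℝ) + 1) / f) →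
      s ∈ N.closest (S i) (sourceCount f c (Fintype.card V)) u := by
    intro i hi s hs u hle
    refine ⟨hs, ?_⟩
    have heq : {s' | s' ∈ S i ∧ N.Closer u s' s} = N.closerSet u s ∩ S i := by
      ext; simp [closerSet, and_comm]
    rw [heq]
    rcases Nat.eq_zero_or_pos i with rfl | hi0
    · have := hle.trans_lt (by
        simpa using rpow_lt_sourceCount (f := f) hc (by omega : 2 ≤ Fintype.card V))
      simpa [hS] using (by exact_mod_cast this : (N.closerSet u s).ncard < sourceCount f c _)
    · simpa [hS, hi0.ne'] using ((hA hn i hi0 hi) u s).2 hle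
  have hstep : ∀ i, ∀ hi : i < f, ∀ s ∈ S i, ∀ z ∈ C.support, 2 * N.graph.dist s z ≤ i * g →
      (∀ u ∈ C.support,
        ((N.closerSet u s).ncard : ℝ) ≤ (Fintype.card V : ℝ) ^ (((i : ℝ) + 1) / f)) →
      ⨅ i, m i ≤ ((f * g : ℕ) : ℕ∞) := by
    intro i hi s hs z hz hd hall
    refine (iInf_le _ ⟨i, hi⟩).trans (((hm ⟨i, hi⟩).le_of_isCycle hC
      (fun u hu => hclosest i hi s hs u (hall u hu)) hz).trans ?_)
    norm_cast
    have : (i + 1) * g ≤ f * g := Nat.mul_le_mul_right _ hi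
    rw [add_mul, one_mul] at this
    omega
  by_contra hM
  -- Invariant of the climb, under the assumption that no scale yields a value of at most f g.
  have key : ∀ i < f, ∃ s ∈ S i, ∃ z ∈ C.support, 2 * N.graph.dist s z ≤ i * g := by
    intro i
    induction i with
    | zero => exact fun _ => ⟨w, by simp [hS], w, by simp, by simp⟩
    | succ i ih =>
      intro hi
      obtain ⟨s, hs, z, hz, hd⟩ := ih (by omega)
      by_contra hno
      refine hM (hstep i (by omega) s hs z hz hd fun u hu => ?_)
      by_contra hbig
      -- The sampled x satisfies d(u,x) ≤ d(u,s) ≤ d(u,z) + d(z,s), that is, at most g/2 + i g/2.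
      obtain ⟨x, hx, hxA⟩ := ((hA hn (i + 1) (by omega) hi) u s).1
        (by push_cast; exact (not_le.1 hbig).le)
      refine hno ⟨x, by simpa [hS] using hxA, u, hu, ?_⟩
      have h1 := dist_le_of_mem_closerSet hx
      have h2 := N.connected.dist_triangle (u := u) (v := z) (w := s)
      have h3 := two_mul_dist_le_of_isCycle hu hz
      rw [N.graph.dist_comm (u := z)] at h2
      rw [N.graph.dist_comm, add_mul, one_mul]
      omega
  obtain ⟨s, hs, z, hz, hd⟩ := key (f - 1) (by omega)
  refine hM (hstep (f - 1) (by omega) s hs z hz hd fun u _ => ?_)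
  have : ((f - 1 : ℕ) : ℝ) + 1 = f := by
    rw [Nat.cast_sub hf]; simp
  rw [this, div_self hf0.ne', Real.rpow_one]
  exact_mod_cast (ncard_closerSet_lt u s).le

theorem le_mul_egirth {f : ℕ} {c : ℝ} {A : ℕ → Set V} {M : ℕ∞} (hf : 1 ≤ f)
    (hc : 1 ≤ c) (h : IsMultiScaleEstimate N f c A M)
    (hA : f < Fintype.card V → ∀ i, 1 ≤ i → i < f → N.IsGoodSample f c i (A i)) :
    M ≤ f * N.graph.egirth := by
  by_cases hac : N.graph.IsAcyclic
  · rw [SimpleGraph.egirth_eq_top.2 hac, ENat.mul_top (by exact_mod_cast (by omega : f ≠ 0))]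
    exact le_top
  · obtain ⟨a, C, hC, hg⟩ := SimpleGraph.exists_egirth_eq_length.2 hac
    rw [hg]
    exact_mod_cast le_mul_length_of_isCycle hf hc h hA hC

end Network

/-! ### Tail bounds for the sampled sets -/

section Sampling

variable {V : Type} [Fintype V]

instance : IsProbabilityMeasure (networkCoinLaw V) := by unfold networkCoinLaw; infer_instance

theorem measure_forall_notMem_eq {F : Set (ℕ → Bool)} (hF : MeasurableSet F) (W : Set V) :
    networkCoinLaw V {ω | ∀ w ∈ W, ω w ∉ F} = (1 - coinLaw F) ^ W.ncard := by
  classical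
  have h : {ω : V → ℕ → Bool | ∀ w ∈ W, ω w ∉ F} =
      Set.pi Set.univ fun w => if w ∈ W then Fᶜ else Set.univ := by
    ext ω
    simp only [Set.mem_ofPred_eq, Set.mem_pi, Set.mem_univ, true_imp_iff]
    refine forall_congr' fun w => ?_
    by_cases hw : w ∈ W <;> simp [hw]
  rw [h, networkCoinLaw, Measure.pi_pi, Set.ncard_eq_toFinset_card']
  simp only [apply_ite coinLaw, measure_univ, prob_compl_eq_one_sub hF]
  rw [Finset.prod_ite]
  simp [Set.toFinset]

/-- Markov's inequality for 2 to the number of sampled vertices of W, a product of independent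
factors of mean 1 + P(F). -/
theorem measure_le_ncard_mul_le {F : Set (ℕ → Bool)} (hF : MeasurableSet F) (W : Set V) (k : ℕ) :
    2 ^ k * networkCoinLaw V {ω | k ≤ (W ∩ {w | ω w ∈ F}).ncard} ≤ (1 + coinLaw F) ^ W.ncard := by
  classical
  let X : V → (V → ℕ → Bool) → ENNReal := fun w ω => 1 + F.indicator (1 : (ℕ → Bool) → ENNReal) (ω w)
  have hm : Measurable fun x : ℕ → Bool => 1 + F.indicator (1 : (ℕ → Bool) → ENNReal) x :=
    Measurable.const_add (measurable_one.indicator hF) 1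
  have hX : iIndepFun X (networkCoinLaw V) := iIndepFun_pi
    (X := fun _ x => 1 + F.indicator (1 : (ℕ → Bool) → ENNReal) x) fun _ => hm.aemeasurable
  have hXm : ∀ w, Measurable (X w) := fun w => hm.comp (measurable_pi_apply w)
  have h1 : ∀ w, ∫⁻ ω, X w ω ∂networkCoinLaw V = 1 + coinLaw F := by
    intro w
    have := (measurePreserving_eval (fun _ : V => coinLaw) w).lintegral_comp hm
    refine Eq.trans this ?_
    rw [lintegral_add_left measurable_const, lintegral_indicator_one hF]
    simp
  have h2 := lintegral_prod_eq_prod_lintegral_of_indepFun W.toFinset X hX hXm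
  simp only [h1, Finset.prod_const, ← Set.ncard_eq_toFinset_card'] at h2
  rw [← h2]
  refine le_trans ?_ (mul_meas_ge_le_lintegral (Finset.measurable_prod _ fun w _ => hXm w) (2 ^ k))
  gcongr with ω
  intro hk
  have h3 : ∏ w ∈ W.toFinset, X w ω = 2 ^ (W ∩ {w | ω w ∈ F}).ncard := by
    have : ∀ w, X w ω = if ω w ∈ F then 2 else 1 := by
      intro w
      by_cases hw : ω w ∈ F
      · simp [X, hw, one_add_one_eq_two]
      · simp [X, hw]
    simp only [this]
    rw [Finset.prod_ite, Set.ncard_eq_toFinset_card']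
    simp only [Finset.prod_const, one_pow, mul_one]
    congr 2
    ext w
    simp
  rw [h3]
  exact pow_le_pow_right₀ (by norm_num) hk

variable {f n : ℕ} {c : ℝ} {F : Set (ℕ → Bool)} {i : ℕ}

/-- (1 - p)^{|W|} ≤ exp(-p |W|), and p n^{i/f} = (c + 3) log₂ n when p is not capped. -/
theorem measure_forall_notMem_le (hn : 2 ≤ n) (hF : MeasurableSet F)
    (hp : coinLaw F = ENNReal.ofReal (sampleProb f c n i)) {W : Set V} (hc : 1 ≤ c)
    (hW : (n : ℝ) ^ ((i : ℝ) / f) ≤ W.ncard) :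
    networkCoinLaw V {ω | ∀ w ∈ W, ω w ∉ F} ≤
      ENNReal.ofReal (Real.exp (-((c + 3) * Real.logb 2 n))) := by
  have hn0 : (0 : ℝ) < n := by positivity
  have hW0 : 0 < W.ncard := by exact_mod_cast (Real.rpow_pos_of_pos hn0 _).trans_le hW
  have hl := Network.one_le_logb hn
  have hp0 : 0 ≤ sampleProb f c n i := by unfold sampleProb; positivity
  rw [measure_forall_notMem_eq hF, hp, ← ENNReal.ofReal_one, ← ENNReal.ofReal_sub _ hp0]
  rcases le_total ((c + 3) * (n : ℝ) ^ (-(i : ℝ) / (f : ℝ)) * Real.logb 2 n) 1 with h | h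
  · have hp1 : sampleProb f c n i ≤ 1 := min_le_right _ _
    rw [← ENNReal.ofReal_pow (sub_nonneg.2 hp1)]
    refine ENNReal.ofReal_le_ofReal ?_
    rw [sampleProb, min_eq_left h]
    set p := (c + 3) * (n : ℝ) ^ (-(i : ℝ) / (f : ℝ)) * Real.logb 2 n with hpd
    refine (pow_le_pow_left₀ (sub_nonneg.2 h) (Real.one_sub_le_exp_neg p) _).trans ?_
    rw [← Real.exp_nat_mul, Real.exp_le_exp, mul_neg, neg_le_neg_iff]
    have hp1 : 0 ≤ p := by positivity
    refine le_trans (le_of_eq ?_) (mul_le_mul_of_nonneg_right hW hp1)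
    rw [hpd, neg_div, Real.rpow_neg hn0.le]
    field_simp
  -- With p capped at 1, a nonempty W is missed with probability 0.
  · rw [sampleProb, min_eq_right h]
    simp [hW0.ne']

/-- For m = (c + 3) n^{1/f} log₂ n the mean p |W| is at most m, so the moment is at most e^m. Since
k ≥ 12 m and log 2 > 1/2, dividing by 2^k ≥ e^{6m} leaves at most e^{-5m}, more than is needed. -/
theorem measure_sourceCount_le_ncard_le (hn : 2 ≤ n) (hF : MeasurableSet F)
    (hp : coinLaw F = ENNReal.ofReal (sampleProb f c n i)) {W : Set V} (hc : 1 ≤ c)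
    (hW : (W.ncard : ℝ) ≤ (n : ℝ) ^ (((i : ℝ) + 1) / f)) :
    networkCoinLaw V {ω | sourceCount f c n ≤ (W ∩ {w | ω w ∈ F}).ncard} ≤
      ENNReal.ofReal (Real.exp (-((c + 3) * Real.logb 2 n))) := by
  have hn0 : (0 : ℝ) < n := by positivity
  have hl := Network.one_le_logb hn
  have hp0 : 0 ≤ sampleProb f c n i := by unfold sampleProb; positivity
  have h := measure_le_ncard_mul_le hF W (sourceCount f c n)
  set k := sourceCount f c n with hk
  have h2 : (2 : ENNReal) ^ k = ENNReal.ofReal (2 ^ k) := by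
    rw [ENNReal.ofReal_pow zero_le_two]; simp
  rw [mul_comm, ← ENNReal.le_div_iff_mul_le (by simp) (by simp)] at h
  refine h.trans ?_
  rw [hp, ← ENNReal.ofReal_one, ← ENNReal.ofReal_add zero_le_one hp0,
    ← ENNReal.ofReal_pow (by positivity), h2, ← ENNReal.ofReal_div_of_pos (by positivity)]
  refine ENNReal.ofReal_le_ofReal ?_
  set m := (c + 3) * (n : ℝ) ^ (1 / (f : ℝ)) * Real.logb 2 n with hm
  have hkm : 12 * m ≤ k := by
    refine le_trans (le_of_eq ?_) (Nat.le_ceil _)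
    rw [hm]; ring
  have hm0 : 0 ≤ m := by positivity
  have hpm : sampleProb f c n i * W.ncard ≤ m := by
    refine (mul_le_mul (min_le_left _ _) hW (by positivity) (by positivity)).trans (le_of_eq ?_)
    have : (n : ℝ) ^ (1 / (f : ℝ)) =
        (n : ℝ) ^ (-(i : ℝ) / (f : ℝ)) * (n : ℝ) ^ (((i : ℝ) + 1) / f) := by
      rw [← Real.rpow_add hn0]; ring_nf
    rw [hm, this]; ring
  have hL : (c + 3) * Real.logb 2 n ≤ m := by
    have : 1 ≤ (n : ℝ) ^ (1 / (f : ℝ)) :=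
      Real.one_le_rpow (by exact_mod_cast (by omega : 1 ≤ n)) (by positivity)
    rw [hm]
    refine mul_le_mul_of_nonneg_right ?_ (by linarith)
    exact le_mul_of_one_le_right (by linarith) this
  have hpow : (1 + sampleProb f c n i) ^ W.ncard ≤ Real.exp m := by
    rw [add_comm]
    refine (pow_le_pow_left₀ (by positivity) (Real.add_one_le_exp _) _).trans ?_
    rw [← Real.exp_nat_mul, Real.exp_le_exp, mul_comm]
    exact hpm
  have h2k : (2 : ℝ) ^ k = Real.exp (k * Real.log 2) := by
    rw [Real.exp_nat_mul, Real.exp_log two_pos]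
  rw [h2k, div_le_iff₀ (Real.exp_pos _), ← Real.exp_add]
  refine hpow.trans (Real.exp_le_exp.2 ?_)
  have hlog := Real.log_two_gt_d9
  have : 12 * m * 0.5 ≤ k * Real.log 2 :=
    mul_le_mul hkm (by linarith) (by norm_num) (by positivity)
  linarith

/-- With t = (c + 3) log₂ n ≥ 4 the right-hand side is e^{-t log 2} / 2, and t (1 - log 2) ≥ log 2.
The factor 1/2 pays for the two bad events of each pair (u, s). -/
theorem exp_neg_mul_logb_le (hn : 2 ≤ n) (hc : 1 ≤ c) :
    Real.exp (-((c + 3) * Real.logb 2 n)) ≤ (n : ℝ) ^ (-(c + 3)) / 2 := by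
  have hn0 : (0 : ℝ) < n := by positivity
  have hl := Network.one_le_logb hn
  have hlog := Real.log_two_lt_d9
  have hlog0 := Real.log_two_gt_d9
  have hnl : Real.log n = Real.logb 2 n * Real.log 2 := by
    rw [Real.logb]; field_simp
  rw [Real.rpow_def_of_pos hn0, ← Real.exp_log (two_pos : (0 : ℝ) < 2), ← Real.exp_sub,
    Real.exp_log two_pos, Real.exp_le_exp, hnl]
  have h4 : 4 ≤ (c + 3) * Real.logb 2 n := by nlinarith
  nlinarith

theorem measure_not_isGoodSample_le (N : Network V) (hn : 2 ≤ Fintype.card V) (hc : 1 ≤ c)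
    (hF : MeasurableSet F)
    (hp : coinLaw F = ENNReal.ofReal (sampleProb f c (Fintype.card V) i)) :
    networkCoinLaw V {ω | ¬ N.IsGoodSample f c i {v | ω v ∈ F}} ≤
      ENNReal.ofReal ((Fintype.card V : ℝ) ^ (-(c + 1))) := by
  classical
  set n := Fintype.card V with hnV
  set q := Real.exp (-((c + 3) * Real.logb 2 n)) with hq
  have hn0 : (0 : ℝ) < n := by positivity
  have hsub : {ω : V → ℕ → Bool | ¬ N.IsGoodSample f c i {v | ω v ∈ F}} ⊆ ⋃ us : V × V,
      ({ω | (n : ℝ) ^ ((i : ℝ) / f) ≤ (N.closerSet us.1 us.2).ncard ∧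
          ∀ w ∈ N.closerSet us.1 us.2, ω w ∉ F} ∪
        {ω | ((N.closerSet us.1 us.2).ncard : ℝ) ≤ (n : ℝ) ^ (((i : ℝ) + 1) / f) ∧
          sourceCount f c n ≤ (N.closerSet us.1 us.2 ∩ {w | ω w ∈ F}).ncard}) := by
    intro ω hω
    simp only [Set.mem_ofPred_eq, Network.IsGoodSample, not_forall, not_and_or, not_exists,
      not_lt, exists_prop] at hω
    obtain ⟨u, s, h⟩ := hω
    refine Set.mem_iUnion.2 ⟨(u, s), h.imp_left fun h => ⟨h.1, fun w hw => ?_⟩⟩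
    exact (h.2 w).resolve_left (not_not.2 hw)
  have hpair : ∀ us : V × V, networkCoinLaw V
      ({ω | (n : ℝ) ^ ((i : ℝ) / f) ≤ (N.closerSet us.1 us.2).ncard ∧
          ∀ w ∈ N.closerSet us.1 us.2, ω w ∉ F} ∪
        {ω | ((N.closerSet us.1 us.2).ncard : ℝ) ≤ (n : ℝ) ^ (((i : ℝ) + 1) / f) ∧
          sourceCount f c n ≤ (N.closerSet us.1 us.2 ∩ {w | ω w ∈ F}).ncard}) ≤
      ENNReal.ofReal q + ENNReal.ofReal q := by
    intro us
    refine (measure_union_le _ _).trans (add_le_add ?_ ?_)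
    · by_cases h : (n : ℝ) ^ ((i : ℝ) / f) ≤ (N.closerSet us.1 us.2).ncard
      · simpa [h] using measure_forall_notMem_le hn hF hp hc h
      · simp [h]
    · by_cases h : ((N.closerSet us.1 us.2).ncard : ℝ) ≤ (n : ℝ) ^ (((i : ℝ) + 1) / f)
      · simpa [h] using measure_sourceCount_le_ncard_le hn hF hp hc h
      · simp [h]
  -- The union over n² pairs lowers the exponent from c + 3 to c + 1.
  refine (measure_mono hsub).trans ((measure_iUnion_fintype_le _ _).trans
    ((Finset.sum_le_sum fun us _ => hpair us).trans ?_))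
  rw [Finset.sum_const, Finset.card_univ, Fintype.card_prod, nsmul_eq_mul,
    ← ENNReal.ofReal_add (Real.exp_pos _).le (Real.exp_pos _).le, ← ENNReal.ofReal_natCast,
    ← ENNReal.ofReal_mul (by positivity), ← hnV]
  refine ENNReal.ofReal_le_ofReal ?_
  have h1 := exp_neg_mul_logb_le (c := c) hn hc
  have h2 : (n : ℝ) ^ (-(c + 1)) = n * n * (n : ℝ) ^ (-(c + 3)) := by
    rw [show -(c + 1) = 1 + 1 + -(c + 3) by ring, Real.rpow_add hn0, Real.rpow_add hn0,
      Real.rpow_one]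
  rw [h2]
  push_cast
  exact mul_le_mul_of_nonneg_left (by linarith) (by positivity)

/-- The approximation guarantee: a result `M` of the multi-scale scheme is an `f`-approximation of
the girth from above, except with probability at most `n^{-c}`. -/
theorem measure_not_approx_le (N : Network V) (hf : 1 ≤ f) (hc : 1 ≤ c)
    {E : ℕ → Set (ℕ → Bool)} (hE : IsSampling f c (Fintype.card V) E)
    {M : (V → ℕ → Bool) → ℕ∞}
    (hM : ∀ ω, IsMultiScaleEstimate N f c (fun i => {v | ω v ∈ E i}) (M ω)) :
    networkCoinLaw V {ω | ¬ (N.graph.egirth ≤ M ω ∧ M ω ≤ (f : ℕ∞) * N.graph.egirth)} ≤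
      ENNReal.ofReal ((Fintype.card V : ℝ) ^ (-c)) := by
  obtain ⟨hEm, -, hEp⟩ := hE
  have hsub : {ω | ¬ (N.graph.egirth ≤ M ω ∧ M ω ≤ (f : ℕ∞) * N.graph.egirth)} ⊆
      {ω | ¬ (f < Fintype.card V → ∀ i, 1 ≤ i → i < f →
        N.IsGoodSample f c i {v | ω v ∈ E i})} := fun ω hω hgood =>
    hω ⟨IsMultiScaleEstimate.egirth_le (hM ω), Network.le_mul_egirth hf hc (hM ω) hgood⟩
  refine (measure_mono hsub).trans ?_
  by_cases hn : f < Fintype.card V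
  swap
  · simp [hn]
  set n := Fintype.card V
  have hn0 : (0 : ℝ) < n := by exact_mod_cast (by omega : 0 < n)
  have hsub' : {ω : V → ℕ → Bool | ¬ (f < n → ∀ i, 1 ≤ i → i < f →
      N.IsGoodSample f c i {v | ω v ∈ E i})} ⊆
      ⋃ i : Fin f, {ω | ¬ N.IsGoodSample f c i {v | ω v ∈ E i}} := by
    intro ω hω
    simp only [Set.mem_ofPred_eq, not_forall, exists_prop] at hω
    obtain ⟨-, i, -, hi, h⟩ := hω
    exact Set.mem_iUnion.2 ⟨⟨i, hi⟩, h⟩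
  -- There are f < n scales, which costs one more factor n.
  refine (measure_mono hsub').trans ((measure_iUnion_fintype_le _ _).trans
    ((Finset.sum_le_sum fun (i : Fin f) _ =>
      measure_not_isGoodSample_le N (i := i) (by omega) hc (hEm i) (hEp i)).trans ?_))
  rw [Finset.sum_const, Finset.card_univ, Fintype.card_fin, nsmul_eq_mul,
    ← ENNReal.ofReal_natCast, ← ENNReal.ofReal_mul (by positivity)]
  refine ENNReal.ofReal_le_ofReal ?_
  have h2 : (n : ℝ) ^ (-c) = n * (n : ℝ) ^ (-(c + 1)) := by
    rw [show -c = 1 + -(c + 1) by ring, Real.rpow_add hn0, Real.rpow_one]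
  rw [h2]
  exact mul_le_mul_of_nonneg_right (by exact_mod_cast hn.le) (by positivity)

end Sampling

/-! ### Broadcast algorithms -/

/-- The number with the given binary digits, least significant digit first. -/
def natOfBits (l : List Bool) : ℕ := l.foldr Nat.bit 0

theorem natOfBits_bits (n : ℕ) : natOfBits n.bits = n := by
  induction n using Nat.binaryRec' with
  | zero => simp [natOfBits]
  | bit b n h ih =>
    rw [Nat.bits_append_bit n b h]
    exact congrArg (Nat.bit b) ih

/-- An algorithm in which every vertex sends, in every round, the same number to all neighbours.
The number sent in a round, and the final result, are functions of the local input and of the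
numbers received so far, by rounds and ports; the number of rounds is known in advance. -/
structure BroadcastAlgorithm where
  message : LocalInput → ℕ → (ℕ → ℕ → ℕ) → ℕ
  rounds : LocalInput → ℕ
  result : LocalInput → (ℕ → ℕ → ℕ) → ℕ∞

/-- A broadcast algorithm as a CONGEST algorithm. -/
noncomputable def BroadcastAlgorithm.toCongest (B : BroadcastAlgorithm) : CongestAlgorithm where
  State := LocalInput × ℕ × (ℕ → ℕ → ℕ)
  start I := (I, 0, fun _ _ => 0)
  send s _ := (B.message s.1 s.2.1 s.2.2).bits
  receive s m := (s.1, s.2.1 + 1, Function.update s.2.2 s.2.1 fun j => natOfBits (m j))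
  output s := if s.2.1 < B.rounds s.1 then none else some (B.result s.1 s.2.2)

namespace Network

variable {V : Type}

/-- The local input of the vertex `v`. -/
def localInput [Fintype V] (N : Network V) (Dapx : ℕ) (ω : V → ℕ → Bool) (v : V) : LocalInput where
  size := Fintype.card V
  diamApprox := Dapx
  ident := N.ident v
  degree := N.deg v
  coins := ω v

/-- What `v` has received before round `t`, by rounds and ports, if `x r u` is the number sent by
`u` in round `r`. -/
def history (N : Network V) (x : ℕ → V → ℕ) (t : ℕ) (v : V) (r j : ℕ) : ℕ :=
  if h : r < t ∧ j < N.deg v then x r (N.port v ⟨j, h.2⟩) else 0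

theorem history_port (N : Network V) (x : ℕ → V → ℕ) {t r : ℕ} (h : r < t) (v : V)
    (j : Fin (N.deg v)) : N.history x t v r j = x r (N.port v j) := by
  simp [history, h]

end Network

/-- Replaces states by the broadcast numbers `x t v` and their recursion. The number of rounds must
be common to all vertices, since a vertex that stopped earlier would fall silent. -/
theorem BroadcastAlgorithm.exists_run {V : Type} [Fintype V] (B : BroadcastAlgorithm)
    (N : Network V) (Dapx : ℕ) (ω : V → ℕ → Bool) {T : ℕ}
    (hT : ∀ v, B.rounds (N.localInput Dapx ω v) = T) :
    ∃ x : ℕ → V → ℕ,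
      (∀ t < T, ∀ v, x t v = B.message (N.localInput Dapx ω v) t (N.history x t v)) ∧
      (∀ t v j, (B.toCongest.message (B.toCongest.stateAfter N Dapx ω t v) j).length ≤
        if t < T then (x t v).size else 0) ∧
      ∀ v, B.toCongest.output (B.toCongest.stateAfter N Dapx ω T v) =
        some (B.result (N.localInput Dapx ω v) (N.history x T v)) := by
  let σ : ℕ → V → LocalInput × ℕ × (ℕ → ℕ → ℕ) := B.toCongest.stateAfter N Dapx ω
  let x : ℕ → V → ℕ := fun t v => B.message (σ t v).1 (σ t v).2.1 (σ t v).2.2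
  have hout : ∀ t v, B.toCongest.output (σ t v) =
      if (σ t v).2.1 < B.rounds (σ t v).1 then none
      else some (B.result (σ t v).1 (σ t v).2.2) := fun _ _ => rfl
  have hσ : ∀ t ≤ T, ∀ v, σ t v = (N.localInput Dapx ω v, t, N.history x t v) := by
    intro t
    induction t with
    | zero =>
      intro _ v
      change (_, 0, fun _ _ => 0) = _
      refine Prod.ext rfl (Prod.ext rfl ?_)
      funext r j
      simp [Network.history]
    | succ t ih =>
      intro ht v
      have ih' := ih (by omega)
      have hnone : ∀ v, B.toCongest.output (σ t v) = none := by
        intro v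
        rw [hout, ih' v]
        simp [hT, show t < T by omega]
      have hmsg : ∀ u j, B.toCongest.message (σ t u) j = (x t u).bits := by
        intro u j
        rw [CongestAlgorithm.message, hnone]
        rfl
      have hstep : σ (t + 1) v = B.toCongest.receive (σ t v) (B.toCongest.inbox N (σ t) v) := by
        change (if (B.toCongest.output (σ t v)).isSome then σ t v else _) = _
        rw [hnone]
        rfl
      have hin : ∀ j, natOfBits (B.toCongest.inbox N (σ t) v j) =
          if h : j < N.deg v then x t (N.port v ⟨j, h⟩) else 0 := by
        intro j
        unfold CongestAlgorithm.inbox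
        split_ifs with h
        · rw [hmsg, natOfBits_bits]
        · rfl
      rw [hstep]
      change ((σ t v).1, (σ t v).2.1 + 1, Function.update (σ t v).2.2 (σ t v).2.1 _) = _
      simp only [hin]
      rw [ih' v]
      refine Prod.ext rfl (Prod.ext rfl ?_)
      funext r j
      rcases lt_trichotomy r t with h | rfl | h
      · simp [Function.update_of_ne h.ne, Network.history, h, show r < t + 1 by omega]
      · simp [Network.history]
      · simp [Function.update_of_ne h.ne', Network.history, show ¬ r < t by omega,
          show ¬ r < t + 1 by omega]
  have hT' : ∀ v, B.toCongest.output (σ T v) =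
      some (B.result (N.localInput Dapx ω v) (N.history x T v)) := by
    intro v
    rw [hout, hσ T le_rfl v]
    simp [hT]
  have hlate : ∀ r v, σ (T + r) v = σ T v := by
    intro r v
    induction r with
    | zero => rfl
    | succ r ih =>
      change (if (B.toCongest.output (σ (T + r) v)).isSome then σ (T + r) v else _) = _
      rw [ih, hT']
      rfl
  refine ⟨x, fun t ht v => ?_, fun t v j => ?_, hT'⟩
  · change B.message (σ t v).1 (σ t v).2.1 (σ t v).2.2 = _
    rw [hσ t ht.le v]
  · change (B.toCongest.message (σ t v) j).length ≤ _
    split_ifs with ht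
    · unfold CongestAlgorithm.message
      split_ifs
      · simp
      · exact (Nat.size_eq_bits_len _).le
    · obtain ⟨r, rfl⟩ := Nat.exists_eq_add_of_le (not_lt.1 ht)
      rw [hlate, CongestAlgorithm.message, hT']
      simp

/-! ### Tables of distances to sources -/

/-- The position of the identifier `s` in the table `L`, which is ordered by distances with ties
broken by identifiers. -/
noncomputable def tableRank (L : ℕ → ℕ∞) (s : ℕ) : ℕ∞ :=
  {s' | toLex (L s', s') < toLex (L s, s)}.encard

theorem toLex_table_mono {L τ : ℕ → ℕ∞} (h : ∀ s, τ s ≤ L s) (s : ℕ) :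
    toLex (τ s, s) ≤ toLex (L s, s) := by
  rw [Prod.Lex.toLex_le_toLex]
  rcases (h s).lt_or_eq with h | h
  · exact Or.inl h
  · exact Or.inr ⟨h, le_rfl⟩

theorem tableRank_le_of_eq {L τ : ℕ → ℕ∞} (h : ∀ s, τ s ≤ L s) {s : ℕ} (hs : L s = τ s) :
    tableRank L s ≤ tableRank τ s := by
  refine Set.encard_le_encard fun s' hs' => ?_
  simp only [Set.mem_ofPred_eq] at hs' ⊢
  rw [hs] at hs'
  exact (toLex_table_mono h s').trans_lt hs'

/-- Distance plus position is strictly increasing along a table, so at most one announcement is due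
per round. -/
theorem add_tableRank_lt_add_tableRank {L : ℕ → ℕ∞} {s s' : ℕ}
    (h : toLex (L s', s') < toLex (L s, s)) (hfin : L s + tableRank L s ≠ ⊤) :
    L s' + tableRank L s' < L s + tableRank L s := by
  have h1 : L s' ≤ L s := by
    rw [Prod.Lex.toLex_lt_toLex] at h
    rcases h with h | h
    · exact h.le
    · exact h.1.le
  have hL : L s ≠ ⊤ := fun h => hfin (by simp [h])
  have hR : tableRank L s ≠ ⊤ := fun h => hfin (by simp [h])
  have hsub : {t | toLex (L t, t) < toLex (L s', s')} ⊂ {t | toLex (L t, t) < toLex (L s, s)} :=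
    ⟨fun t ht => lt_trans ht h, fun hsub => by simpa using hsub h⟩
  have hfin' : {t | toLex (L t, t) < toLex (L s', s')}.Finite :=
    (Set.encard_ne_top_iff.1 hR).subset hsub.subset
  have h2 : tableRank L s' < tableRank L s := hfin'.encard_lt_encard hsub
  exact ENat.add_lt_add_of_le_of_lt (ne_top_of_le_ne_top hL h1) h1 h2

/-- `L` is an upper bound of the table `τ` that is exact for its first `k` entries. -/
def ApproximatesTable (k : ℕ) (L τ : ℕ → ℕ∞) : Prop :=
  (∀ s, τ s ≤ L s) ∧ ∀ s, tableRank τ s < k → L s = τ s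

theorem ApproximatesTable.tableRank_lt {k : ℕ} {L τ : ℕ → ℕ∞} (h : ApproximatesTable k L τ) {s : ℕ}
    (hs : tableRank τ s < k) : tableRank L s < k :=
  (tableRank_le_of_eq h.1 (h.2 s hs)).trans_lt hs

/-- Otherwise let m be the first entry of τ of rank at least k. All entries before m are exact in L
and precede s there, so s has rank at least k in L as well. -/
theorem ApproximatesTable.tableRank_lt_of_lt {k : ℕ} {L τ : ℕ → ℕ∞} (h : ApproximatesTable k L τ)
    {s : ℕ} (hs : tableRank L s < k) : tableRank τ s < k := by
  by_contra hk
  obtain ⟨m, hm, hmin⟩ := WellFounded.has_min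
    (InvImage.wf (fun t => toLex (τ t, t)) (wellFounded_lt (α := ℕ∞ ×ₗ ℕ)))
    {m | ¬ tableRank τ m < k} ⟨s, hk⟩
  refine hm (lt_of_le_of_lt ?_ hs)
  refine Set.encard_le_encard fun t ht => ?_
  have ht' : tableRank τ t < k := not_not.1 fun h' => hmin t h' ht
  simp only [Set.mem_ofPred_eq] at ht ⊢
  rw [h.2 t ht']
  exact (ht.trans_le (not_lt.1 (hmin s hk))).trans_le (toLex_table_mono h.1 s)

/-- The least port `j` behind which the distance to `s` is one less, if there is any. -/
noncomputable def parentPort (deg : ℕ) (L : ℕ → ℕ → ℕ∞) (O : ℕ → ℕ∞) (s : ℕ) : ℕ :=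
  sInf {j | j < deg ∧ L j s + 1 = O s}

/-- The part of the estimate that a vertex of degree `deg` computes from its own table `O` and the
tables `L j` of its neighbours. -/
noncomputable def localEstimate (deg k : ℕ) (L : ℕ → ℕ → ℕ∞) (O : ℕ → ℕ∞) : ℕ∞ :=
  ⨅ (j : ℕ) (s : ℕ) (_ : j < deg ∧ tableRank O s < k ∧ tableRank (L j) s < k ∧ L j s ≤ O s ∧
    j ≠ parentPort deg L O s), O s + L j s + 1

theorem localEstimate_congr {deg k : ℕ} {L L' : ℕ → ℕ → ℕ∞} {O : ℕ → ℕ∞}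
    (h : ∀ j < deg, L j = L' j) : localEstimate deg k L O = localEstimate deg k L' O := by
  have hp : ∀ s, parentPort deg L O s = parentPort deg L' O s := by
    intro s
    unfold parentPort
    congr 1
    ext j
    exact and_congr_right fun hj => by rw [h j hj]
  unfold localEstimate
  refine iInf_congr fun j => iInf_congr fun s => ?_
  by_cases hj : j < deg
  · rw [h j hj, hp]
  · simp [hj]

namespace Network

variable {V : Type}

/-- The table of the distances of `v` to the sources in `S`. -/
noncomputable def sourceTable (N : Network V) (S : Set V) (v : V) (a : ℕ) : ℕ∞ :=
  ⨅ (s : V) (_ : s ∈ S ∧ N.ident s = a), (N.graph.dist s v : ℕ∞)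

variable {N : Network V} {S : Set V} {k : ℕ}

theorem sourceTable_ident {s : V} (hs : s ∈ S) (v : V) :
    N.sourceTable S v (N.ident s) = N.graph.dist s v := by
  refine le_antisymm (iInf₂_le s ⟨hs, rfl⟩) (le_iInf₂ fun s' h => ?_)
  rw [N.ident_injective h.2]

theorem exists_of_sourceTable_ne_top {v : V} {a : ℕ} (h : N.sourceTable S v a ≠ ⊤) :
    ∃ s ∈ S, N.ident s = a := by
  by_contra hno
  refine h (iInf₂_eq_top.2 fun s hs => (hno ⟨s, hs⟩).elim)

theorem sourceTable_le_add_one (N : Network V) (S : Set V) {u v : V} (h : N.graph.Adj v u) (a : ℕ) :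
    N.sourceTable S v a ≤ N.sourceTable S u a + 1 := by
  by_cases hu : N.sourceTable S u a = ⊤
  · simp [hu]
  · obtain ⟨s, hs, rfl⟩ := exists_of_sourceTable_ne_top hu
    rw [sourceTable_ident hs, sourceTable_ident hs]
    exact_mod_cast N.dist_le_dist_add_one s h.symm

theorem toLex_sourceTable_lt_iff {s s' : V} (hs : s ∈ S) (hs' : s' ∈ S) (v : V) :
    toLex (N.sourceTable S v (N.ident s'), N.ident s') <
      toLex (N.sourceTable S v (N.ident s), N.ident s) ↔ N.Closer v s' s := by
  rw [Prod.Lex.toLex_lt_toLex, sourceTable_ident hs, sourceTable_ident hs', Closer,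
    N.graph.dist_comm (u := v), N.graph.dist_comm (u := v)]
  simp

theorem tableRank_sourceTable {s : V} (hs : s ∈ S) (v : V) :
    tableRank (N.sourceTable S v) (N.ident s) = {s' | s' ∈ S ∧ N.Closer v s' s}.encard := by
  rw [tableRank, ← N.ident_injective.injOn.encard_image]
  congr 1
  ext a
  simp only [Set.mem_ofPred_eq, Set.mem_image]
  constructor
  · intro h
    have : N.sourceTable S v a ≠ ⊤ := by
      intro htop
      rw [Prod.Lex.toLex_lt_toLex, htop, sourceTable_ident hs] at h
      simp at h
    obtain ⟨s', hs', rfl⟩ := exists_of_sourceTable_ne_top this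
    exact ⟨s', ⟨hs', (toLex_sourceTable_lt_iff hs hs' v).1 h⟩, rfl⟩
  · rintro ⟨s', ⟨hs', h⟩, rfl⟩
    exact (toLex_sourceTable_lt_iff hs hs' v).2 h

/-- From u to v the distance to s grows by exactly one, to any other source by at most one; sources
closer than s at u stay closer at v. -/
theorem tableRank_sourceTable_le {u v : V} (h : N.graph.Adj v u) {s : V}
    (hs : s ∈ S) (hd : N.graph.dist s u + 1 = N.graph.dist s v) :
    tableRank (N.sourceTable S u) (N.ident s) ≤ tableRank (N.sourceTable S v) (N.ident s) := by
  rw [tableRank_sourceTable hs, tableRank_sourceTable hs]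
  refine Set.encard_le_encard fun s' ⟨hs', hc⟩ => ⟨hs', ?_⟩
  have h1 := N.dist_le_dist_add_one s' h.symm
  rw [Closer, N.graph.dist_comm, N.graph.dist_comm (v := s)] at hc ⊢
  omega

theorem exists_adj_dist_add_one (N : Network V) {s v : V} (h : s ≠ v) :
    ∃ u, N.graph.Adj v u ∧ N.graph.dist s u + 1 = N.graph.dist s v := by
  obtain ⟨p, hp⟩ := N.connected.exists_walk_length_eq_dist v s
  cases p with
  | nil => exact (h rfl).elim
  | @cons _ u _ hvu q =>
    refine ⟨u, hvu, le_antisymm ?_ (N.dist_le_dist_add_one s hvu.symm)⟩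
    have := SimpleGraph.dist_le q
    rw [SimpleGraph.Walk.length_cons, N.graph.dist_comm] at hp
    rw [N.graph.dist_comm] at this
    omega

variable [Fintype V]

theorem tableRank_sourceTable_lt_iff {s : V} (hs : s ∈ S) (v : V) :
    tableRank (N.sourceTable S v) (N.ident s) < k ↔ s ∈ N.closest S k v := by
  rw [tableRank_sourceTable hs, ← (Set.toFinite _).cast_ncard_eq, Nat.cast_lt]
  exact (and_iff_right hs).symm

theorem dist_lt_card (N : Network V) (u v : V) : N.graph.dist u v < Fintype.card V := by
  obtain ⟨p, hp, hl⟩ := N.connected.exists_path_of_dist u v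
  rw [← hl]
  exact hp.length_lt

/-- If all vertices know, up to errors beyond the first `k` entries, their tables and those of
their neighbours, then the minimum of what they compute locally is a result of the estimation
procedure. -/
theorem isEstimate_iInf_localEstimate {O : V → ℕ → ℕ∞} {L : V → ℕ → ℕ → ℕ∞}
    (hO : ∀ v, ApproximatesTable k (O v) (N.sourceTable S v))
    (hL : ∀ v (j : Fin (N.deg v)), ApproximatesTable k (L v j) (N.sourceTable S (N.port v j))) :
    N.IsEstimate S k (⨅ v, localEstimate (N.deg v) k (L v) (O v)) := by
  classical
  set par : V → V → ℕ := fun s v => parentPort (N.deg v) (L v) (O v) (N.ident s) with hpar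
  have hOs : ∀ {s v}, s ∈ N.closest S k v → O v (N.ident s) = N.graph.dist s v := by
    intro s v hs
    rw [(hO v).2 _ ((tableRank_sourceTable_lt_iff hs.1 v).2 hs), sourceTable_ident hs.1]
  have hLs : ∀ {s v} {j : Fin (N.deg v)}, s ∈ N.closest S k (N.port v j) →
      L v j (N.ident s) = N.graph.dist s (N.port v j) := by
    intro s v j hs
    rw [(hL v j).2 _ ((tableRank_sourceTable_lt_iff hs.1 _).2 hs), sourceTable_ident hs.1]
  -- A neighbour one step nearer to s also has s among its k closest sources. Its entry is thus
  -- exact, and some port qualifies as parent.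
  have hparent : ∀ {s v}, s ∈ N.closest S k v → s ≠ v → ∃ h : par s v < N.deg v,
      N.graph.dist s (N.port v ⟨par s v, h⟩) + 1 = N.graph.dist s v := by
    intro s v hs hsv
    have hne : {j | j < N.deg v ∧ L v j (N.ident s) + 1 = O v (N.ident s)}.Nonempty := by
      obtain ⟨u, huv, hd⟩ := N.exists_adj_dist_add_one hsv
      obtain ⟨j, hj⟩ := (N.port v).surjective ⟨u, huv⟩
      have hju : (N.port v j : V) = u := by rw [hj]
      have hsu : s ∈ N.closest S k (N.port v j) := by
        rw [hju, ← tableRank_sourceTable_lt_iff hs.1]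
        exact (tableRank_sourceTable_le huv hs.1 hd).trans_lt
          ((tableRank_sourceTable_lt_iff hs.1 v).2 hs)
      refine ⟨j, j.2, ?_⟩
      rw [hLs hsu, hOs hs, hju]
      exact_mod_cast hd
    obtain ⟨h, he⟩ : par s v < N.deg v ∧ L v (par s v) (N.ident s) + 1 = O v (N.ident s) :=
      Nat.sInf_mem hne
    -- The entry at the chosen port may overestimate, but the true distance cannot drop by more than
    -- one along an edge.
    refine ⟨h, le_antisymm ?_ (N.dist_le_dist_add_one s (N.port v ⟨par s v, h⟩).2.symm)⟩
    have h1 := (hL v ⟨par s v, h⟩).1 (N.ident s)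
    rw [sourceTable_ident hs.1] at h1
    rw [hOs hs] at he
    have h2 := add_le_add_left h1 1
    rw [he] at h2
    exact_mod_cast h2
  let p : V → V → Option V := fun s v =>
    if s = v then none else if h : par s v < N.deg v then some (N.port v ⟨par s v, h⟩) else none
  have hpne : ∀ {s v u}, s ∈ N.closest S k v → p s v = some u →
      N.graph.dist s u + 1 = N.graph.dist s v := by
    intro s v u hs hu
    simp only [p] at hu
    split_ifs at hu with h1 h2
    obtain ⟨h, hd⟩ := hparent hs h1
    rw [← Option.some_injective _ hu]
    exact hd
  refine ⟨p, fun v s hs => ⟨fun h => if_pos h, fun h => ?_⟩, le_antisymm ?_ ?_⟩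
  · obtain ⟨hlt, hd⟩ := hparent hs h
    exact ⟨N.port v ⟨par s v, hlt⟩, by simp [p, h, hlt], (N.port v ⟨par s v, hlt⟩).2.symm, hd⟩
  · have half : ∀ {x y s}, N.graph.Adj x y → s ∈ N.closest S k x → s ∈ N.closest S k y →
        p s x ≠ some y → N.graph.dist s y ≤ N.graph.dist s x →
        ⨅ v, localEstimate (N.deg v) k (L v) (O v) ≤
          ((N.graph.dist s x + N.graph.dist s y + 1 : ℕ) : ℕ∞) := by
      intro x y s hxy hx hy hpx hle
      obtain ⟨j, hj⟩ := (N.port x).surjective ⟨y, hxy⟩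
      have hjy : (N.port x j : V) = y := by rw [hj]
      -- The root is strictly nearer to s than its neighbours, so the default value 0 of
      -- `parentPort` plays no role here.
      have hsx : s ≠ x := by
        rintro rfl
        have := N.connected.pos_dist_of_ne hxy.ne
        rw [SimpleGraph.dist_self] at hle
        omega
      have hy' : s ∈ N.closest S k (N.port x j) := by rwa [hjy]
      have e1 := hOs hx
      have e2 := hLs hy'
      rw [hjy] at e2
      refine iInf_le_of_le x <| iInf_le_of_le (j : ℕ) <| iInf_le_of_le (N.ident s) <|
        iInf_le_of_le ⟨j.2, (hO x).tableRank_lt ((tableRank_sourceTable_lt_iff hx.1 x).2 hx),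
          (hL x j).tableRank_lt ((tableRank_sourceTable_lt_iff hx.1 _).2 hy'), ?_, ?_⟩ ?_
      · rw [e1, e2]; exact_mod_cast hle
      · intro hjp
        refine hpx ?_
        have : par s x < N.deg x := lt_of_eq_of_lt hjp.symm j.2
        have hj' : (⟨par s x, this⟩ : Fin (N.deg x)) = j := Fin.ext hjp.symm
        simp [p, hsx, this, hj', hjy]
      · rw [e1, e2]; norm_cast
    refine le_iInf fun x => le_iInf fun y => le_iInf fun s => le_iInf fun h => ?_
    obtain ⟨hxy, hx, hy, hpx, hpy⟩ := h
    rcases le_total (N.graph.dist s y) (N.graph.dist s x) with h | h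
    · exact half hxy hx hy hpx h
    · rw [add_comm (N.graph.dist s x)]
      exact half hxy.symm hy hx hpy h
  · refine le_iInf fun x => le_iInf fun j => le_iInf fun a => le_iInf fun h => ?_
    obtain ⟨hj, hrx, hry, hle, hne⟩ := h
    set y : V := (N.port x ⟨j, hj⟩).1 with hy
    have hLy := hL x ⟨j, hj⟩
    have hrx' := (hO x).tableRank_lt_of_lt hrx
    have hry' := hLy.tableRank_lt_of_lt hry
    by_cases htop : N.sourceTable S x a = ⊤
    · have := (hO x).1 a
      rw [htop, top_le_iff] at this
      simp [this]
    obtain ⟨s, hs, rfl⟩ := exists_of_sourceTable_ne_top htop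
    have hx : s ∈ N.closest S k x := (tableRank_sourceTable_lt_iff hs x).1 hrx'
    have hy' : s ∈ N.closest S k y := (tableRank_sourceTable_lt_iff hs y).1 hry'
    have e1 := hOs hx
    have e2 := hLs (j := ⟨j, hj⟩) hy'
    simp only at e2
    rw [e1, e2] at hle ⊢
    have hle' : N.graph.dist s y ≤ N.graph.dist s x := by exact_mod_cast hle
    refine (estimate_le (N.port x ⟨j, hj⟩).2 hx hy' ?_ ?_).trans (by norm_cast)
    · intro hpx
      simp only [p] at hpx
      split_ifs at hpx with h1 h2
      have := (N.port x).injective (Subtype.ext (Option.some_injective _ hpx))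
      exact hne (congrArg Fin.val this).symm
    · intro hpy
      have := hpne hy' hpy
      omega

/-- Justifies the cutoff 2n in the flooding: only infinite values are suppressed. -/
theorem localEstimate_eq_top_or_le {O : V → ℕ → ℕ∞} {L : V → ℕ → ℕ → ℕ∞}
    (hO : ∀ v, ApproximatesTable k (O v) (N.sourceTable S v))
    (hL : ∀ v (j : Fin (N.deg v)), ApproximatesTable k (L v j) (N.sourceTable S (N.port v j)))
    (v : V) : localEstimate (N.deg v) k (L v) (O v) = ⊤ ∨
      localEstimate (N.deg v) k (L v) (O v) ≤ (2 * Fintype.card V : ℕ) := by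
  rw [or_iff_not_imp_left]
  intro hne
  simp only [localEstimate, iInf_eq_top, not_forall] at hne
  obtain ⟨j, a, h, hne⟩ := hne
  refine (iInf_le_of_le j <| iInf_le_of_le a <| iInf_le _ h).trans ?_
  obtain ⟨hj, hrx, hry, -⟩ := h
  have e1 := (hO v).2 a ((hO v).tableRank_lt_of_lt hrx)
  have e2 := (hL v ⟨j, hj⟩).2 a ((hL v ⟨j, hj⟩).tableRank_lt_of_lt hry)
  simp only at e2
  have htop : N.sourceTable S v a ≠ ⊤ := fun h => hne (by simp [e1, h])
  obtain ⟨s, hs, rfl⟩ := exists_of_sourceTable_ne_top htop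
  rw [e1, e2, sourceTable_ident hs, sourceTable_ident hs]
  have h1 := N.dist_lt_card s v
  have h2 := N.dist_lt_card s (N.port v ⟨j, hj⟩)
  norm_cast
  omega

end Network

/-! ### Source detection and flooding -/

/-- The least distance to the source `s` announced by the numbers `y t` with `a ≤ t < b`. -/
noncomputable def heardTable (a b : ℕ) (y : ℕ → ℕ) (s : ℕ) : ℕ∞ :=
  ⨅ (t : ℕ) (d : ℕ) (_ : a ≤ t ∧ t < b ∧ y t = Nat.pair d s + 1), (d : ℕ∞)

/-- The table of a vertex with identifier `ident` and degree `deg` that has heard the tables `L j`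
from its neighbours; `src` tells whether the vertex is a source itself. -/
noncomputable def ownTable (deg : ℕ) (src : Prop) (ident : ℕ) (L : ℕ → ℕ → ℕ∞) (s : ℕ) : ℕ∞ :=
  (⨅ _ : src ∧ s = ident, 0) ⊓ ⨅ (j : ℕ) (_ : j < deg), L j s + 1

open Classical in
/-- The announcement that is due in round `r` of the source detection: the entry of the table whose
distance and position add up to `r`. -/
noncomputable def detectionMessage (n r : ℕ) (L : ℕ → ℕ∞) : ℕ :=
  if h : ∃ s, L s < n ∧ L s + tableRank L s = r then
    Nat.pair (L h.choose).toNat h.choose + 1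
  else 0

/-- The choice is unambiguous because sums of distance and position are distinct. The added 1
reserves the number 0 for silence. -/
theorem detectionMessage_eq {n r : ℕ} {L : ℕ → ℕ∞} {s : ℕ} (h1 : L s < n)
    (h2 : L s + tableRank L s = r) : detectionMessage n r L = Nat.pair (L s).toNat s + 1 := by
  have h : ∃ s, L s < n ∧ L s + tableRank L s = r := ⟨s, h1, h2⟩
  have hs : h.choose = s := by
    have h3 := h.choose_spec.2
    rcases lt_trichotomy (toLex (L h.choose, h.choose)) (toLex (L s, s)) with hlt | heq | hlt
    · have := add_tableRank_lt_add_tableRank hlt (by simp [h2])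
      rw [h2, h3] at this
      exact (lt_irrefl _ this).elim
    · simpa using (congrArg (fun q => (ofLex q).2) heq)
    · have := add_tableRank_lt_add_tableRank hlt (by simp [h3])
      rw [h2, h3] at this
      exact (lt_irrefl _ this).elim
  rw [detectionMessage, dif_pos h, hs]

theorem eq_of_detectionMessage_eq {n r d s : ℕ} {L : ℕ → ℕ∞}
    (h : detectionMessage n r L = Nat.pair d s + 1) : L s = d ∧ d < n := by
  unfold detectionMessage at h
  split_ifs at h with hex
  have hp := Nat.pair_eq_pair.1 (Nat.succ_injective h)
  have hspec := hex.choose_spec.1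
  rw [hp.2] at hspec hp
  have : L s = d := by
    rw [← hp.1, ENat.natCast_toNat (ne_top_of_lt hspec)]
  rw [this] at hspec
  exact ⟨this, by exact_mod_cast hspec⟩

/-- Both components are below 2^{(a+1)l} and `Nat.pair` is at most quadratic; one further l absorbs
the added 1. -/
theorem size_pair_add_one_le {d s l a : ℕ} (hd : d < 2 ^ l) (hs : s < 2 ^ (a * l)) (hl : 1 ≤ l) :
    (Nat.pair d s + 1).size ≤ (2 * a + 3) * l := by
  rw [Nat.size_le]
  have h1 : d < 2 ^ ((a + 1) * l) :=
    hd.trans_le (Nat.pow_le_pow_right two_pos (Nat.le_mul_of_pos_left _ (by omega)))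
  have h2 : s < 2 ^ ((a + 1) * l) :=
    hs.trans_le (Nat.pow_le_pow_right two_pos (Nat.mul_le_mul_right _ (by omega)))
  have h3 : (max d s + 1) ^ 2 ≤ (2 ^ ((a + 1) * l)) ^ 2 := Nat.pow_le_pow_left (by omega) 2
  have h4 := Nat.pair_lt_max_add_one_sq d s
  have h5 : (2 ^ ((a + 1) * l)) ^ 2 < 2 ^ ((2 * a + 3) * l) := by
    rw [← pow_mul]
    exact Nat.pow_lt_pow_right one_lt_two (by nlinarith)
  omega

/-- What a vertex of degree `deg` with initial value `m₀` knows in round `t` about the minimum of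
all values, if the flooding has started in round `a` and `h` has been received so far. -/
noncomputable def floodValue (m₀ : ℕ∞) (a t deg : ℕ) (h : ℕ → ℕ → ℕ) : ℕ∞ :=
  m₀ ⊓ ⨅ (r : ℕ) (j : ℕ) (m : ℕ) (_ : a ≤ r ∧ r < t ∧ j < deg ∧ h r j = m + 1), (m : ℕ∞)

open Classical in
/-- The encoding of a value of at most `B`; greater values are ignored. -/
noncomputable def floodMessage (B : ℕ) (m : ℕ∞) : ℕ := if m ≤ B then m.toNat + 1 else 0

theorem eq_of_floodMessage_eq {B m : ℕ} {x : ℕ∞} (h : floodMessage B x = m + 1) : x = m := by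
  unfold floodMessage at h
  split_ifs at h with hx
  rw [← Nat.succ_injective h, ENat.natCast_toNat (ne_top_of_le_ne_top (ENat.natCast_ne_top B) hx)]

theorem floodMessage_eq {B : ℕ} {x : ℕ∞} (h : x ≤ B) : floodMessage B x = x.toNat + 1 := if_pos h

theorem floodMessage_le (B : ℕ) (x : ℕ∞) : floodMessage B x ≤ B + 1 := by
  unfold floodMessage
  split_ifs with h
  · have := ENat.toNat_le_toNat h (ENat.natCast_ne_top B)
    simpa using this
  · omega

/-! ### Correctness of flooding and of source detection -/

namespace Network

variable {V : Type} {N : Network V} {S : Set V} {x : ℕ → V → ℕ} {a R : ℕ}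

/-- The table that `v` computes in round `t` from what it has received in the rounds `a, …, b - 1`,
if the set of sources is `S`. -/
noncomputable def knownTable (N : Network V) (S : Set V) (x : ℕ → V → ℕ) (a b t : ℕ) (v : V) :
    ℕ → ℕ∞ :=
  ownTable (N.deg v) (v ∈ S) (N.ident v) fun j => heardTable a b (N.history x t v · j)

theorem heardTable_history {b t : ℕ} (hb : b ≤ t) (v : V) (j : Fin (N.deg v)) :
    heardTable a b (N.history x t v · j) = heardTable a b (x · (N.port v j)) := by
  funext s
  unfold heardTable
  refine iInf_congr fun r => iInf_congr fun d => iInf_congr_Prop ?_ fun _ => rfl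
  beta_reduce
  constructor <;> rintro ⟨h1, h2, h3⟩
  · exact ⟨h1, h2, by rwa [N.history_port x (h2.trans_le hb)] at h3⟩
  · exact ⟨h1, h2, by rwa [N.history_port x (h2.trans_le hb)]⟩

theorem knownTable_eq_of_le {b t : ℕ} (hb : b ≤ t) (v : V) :
    N.knownTable S x a b t v = N.knownTable S x a b b v := by
  funext s
  unfold knownTable ownTable
  congr 1
  refine iInf_congr fun j => iInf_congr fun hj => ?_
  have h1 := heardTable_history (N := N) (x := x) (a := a) hb v ⟨j, hj⟩
  have h2 := heardTable_history (N := N) (x := x) (a := a) (le_refl b) v ⟨j, hj⟩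
  beta_reduce
  rw [h1, h2]

theorem knownTable_le_heardTable_add_one {b t : ℕ} (hb : b ≤ t) {v u : V}
    (h : N.graph.Adj v u) (s : ℕ) :
    N.knownTable S x a b t v s ≤ heardTable a b (x · u) s + 1 := by
  obtain ⟨j, hj⟩ := (N.port v).surjective ⟨u, h⟩
  refine inf_le_right.trans (iInf₂_le_of_le (j : ℕ) j.2 ?_)
  beta_reduce
  rw [heardTable_history hb, hj]

theorem sourceTable_le_knownTable {b t : ℕ} (hb : b ≤ t) {v : V} {s : ℕ}
    (h : ∀ u, N.graph.Adj v u → N.sourceTable S u s ≤ heardTable a b (x · u) s) :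
    N.sourceTable S v s ≤ N.knownTable S x a b t v s := by
  refine le_inf (le_iInf fun hs => ?_) (le_iInf₂ fun j hj => ?_)
  · rw [hs.2, sourceTable_ident hs.1, SimpleGraph.dist_self, Nat.cast_zero]
  · have hadj : N.graph.Adj v (N.port v ⟨j, hj⟩) := (N.port v ⟨j, hj⟩).2
    refine (N.sourceTable_le_add_one S hadj s).trans ?_
    have h1 := heardTable_history (N := N) (x := x) (a := a) hb v ⟨j, hj⟩
    beta_reduce
    rw [h1]
    gcongr
    exact h _ hadj

/-- All vertices flood the minimum of the values `m v ≤ B` in the rounds `a, …, a + R - 1`. -/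
def IsFlooding (N : Network V) (m : V → ℕ∞) (B : ℕ) (x : ℕ → V → ℕ) (a R : ℕ) : Prop :=
  ∀ r < R, ∀ v, x (a + r) v =
    floodMessage B (floodValue (m v) a (a + r) (N.deg v) (N.history x (a + r) v))

theorem IsFlooding.floodValue_eq {m : V → ℕ∞} {B : ℕ} (hx : N.IsFlooding m B x a R)
    (hm : ∀ v, m v = ⊤ ∨ m v ≤ B) (hD : ∀ u v, N.graph.dist u v ≤ R) (v : V) :
    floodValue (m v) a (a + R) (N.deg v) (N.history x (a + R) v) = ⨅ u, m u := by
  have lower : ∀ r ≤ R, ∀ v, ⨅ u, m u ≤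
      floodValue (m v) a (a + r) (N.deg v) (N.history x (a + r) v) := by
    intro r
    induction r using Nat.strong_induction_on with
    | _ r ih =>
      refine fun hr v => le_inf (iInf_le _ v) ?_
      refine le_iInf fun t => le_iInf fun j => le_iInf fun i => le_iInf fun h => ?_
      obtain ⟨hat, htr, hj, he⟩ := h
      obtain ⟨q, rfl⟩ := Nat.exists_eq_add_of_le hat
      rw [N.history_port x htr v ⟨j, hj⟩, hx q (by omega)] at he
      rw [← eq_of_floodMessage_eq he]
      exact ih q (by omega) (by omega) _
  -- A value u at distance at most r has arrived after r rounds: the next vertex towards u held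
  -- something no larger, hence at most B, and therefore sent it.
  have upper : ∀ r ≤ R, ∀ v u, N.graph.dist u v ≤ r → m u ≤ B →
      floodValue (m v) a (a + r) (N.deg v) (N.history x (a + r) v) ≤ m u := by
    intro r
    induction r with
    | zero =>
      intro _ v u hd _
      have : u = v := N.connected.dist_eq_zero_iff.1 (Nat.le_zero.1 hd)
      rw [this]
      exact inf_le_left
    | succ r ih =>
      intro hr v u hd hu
      by_cases huv : u = v
      · rw [huv]
        exact inf_le_left
      obtain ⟨w, hvw, hw⟩ := N.exists_adj_dist_add_one huv
      have hF := ih (by omega) w u (by omega) hu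
      have hB := hF.trans hu
      have hsent := hx r (by omega) w
      rw [floodMessage_eq hB] at hsent
      obtain ⟨j, hj⟩ := (N.port v).surjective ⟨w, hvw⟩
      refine le_trans (inf_le_right.trans ?_) hF
      refine iInf_le_of_le (a + r) <| iInf_le_of_le (j : ℕ) <| iInf_le_of_le _ <|
        iInf_le_of_le ⟨by omega, by omega, j.2, ?_⟩ (ENat.natCast_toNat ?_).le
      · rw [N.history_port x (by omega), hj]
        exact hsent
      · exact ne_top_of_le_ne_top (ENat.natCast_ne_top B) hB
  refine le_antisymm (le_iInf fun u => ?_) (lower R le_rfl v)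
  rcases hm u with h | h
  · rw [h]
    exact le_top
  · exact upper R le_rfl v u (hD u v) h

variable [Fintype V]

/-- All vertices follow the source detection protocol for `S` in the rounds `a, …, a + R - 1`. -/
def IsDetection (N : Network V) (S : Set V) (x : ℕ → V → ℕ) (a R : ℕ) : Prop :=
  ∀ r < R, ∀ v, x (a + r) v =
    detectionMessage (Fintype.card V) r (N.knownTable S x a (a + r) (a + r) v)

theorem IsDetection.sourceTable_le (hx : N.IsDetection S x a R) (r : ℕ) (hr : r ≤ R) :
    (∀ u s, N.sourceTable S u s ≤ heardTable a (a + r) (x · u) s) ∧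
    ∀ v s, N.sourceTable S v s ≤ N.knownTable S x a (a + r) (a + r) v s := by
  induction r using Nat.strong_induction_on with
  | _ r ih =>
    have h1 : ∀ u s, N.sourceTable S u s ≤ heardTable a (a + r) (x · u) s := by
      refine fun u s => le_iInf fun t => le_iInf fun d => le_iInf fun h => ?_
      obtain ⟨hat, htr, hd⟩ := h
      obtain ⟨q, rfl⟩ := Nat.exists_eq_add_of_le hat
      beta_reduce at hd
      rw [hx q (by omega)] at hd
      rw [← (eq_of_detectionMessage_eq hd).1]
      exact (ih q (by omega) (by omega)).2 u s
    exact ⟨h1, fun v s => sourceTable_le_knownTable le_rfl fun u _ => h1 u s⟩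

/-- Known tables never underestimate, so a finite announced entry belongs to a genuine source, whose
identifier is short. -/
theorem IsDetection.size_le (hx : N.IsDetection S x a R) {a₀ r : ℕ} (hr : r < R)
    (hid : ∀ v, Nat.size (N.ident v) ≤ a₀ * (Nat.log 2 (Fintype.card V) + 1)) (v : V) :
    (x (a + r) v).size ≤ (2 * a₀ + 3) * (Nat.log 2 (Fintype.card V) + 1) := by
  rcases hy : x (a + r) v with _ | y
  · simp
  rw [← Nat.pair_unpair y] at hy ⊢
  rw [hx r hr v] at hy
  obtain ⟨hs, hd⟩ := eq_of_detectionMessage_eq hy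
  have hle := (hx.sourceTable_le r hr.le).2 v y.unpair.2
  rw [hs] at hle
  obtain ⟨s, -, he⟩ := exists_of_sourceTable_ne_top (ne_top_of_le_ne_top (ENat.natCast_ne_top _) hle)
  rw [← he]
  exact size_pair_add_one_le (hd.trans (Nat.lt_pow_succ_log_self one_lt_two _))
    (Nat.size_le.1 (hid s)) (by omega)

/-- The entries preceding s are due before round r, hence exact by assumption. So s has its true
position in the computed table and is due exactly in round r. -/
theorem IsDetection.sent_eq (hx : N.IsDetection S x a R) {r : ℕ} (hr : r < R)
    (hex : ∀ v s, N.sourceTable S v s + tableRank (N.sourceTable S v) s ≤ r →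
      N.knownTable S x a (a + r) (a + r) v s = N.sourceTable S v s) {v : V} {s : ℕ}
    (hs : N.sourceTable S v s + tableRank (N.sourceTable S v) s = r) :
    x (a + r) v = Nat.pair (N.sourceTable S v s).toNat s + 1 := by
  have hle := (hx.sourceTable_le r hr.le).2 v
  have hK := hex v s hs.le
  have hrank : tableRank (N.knownTable S x a (a + r) (a + r) v) s =
      tableRank (N.sourceTable S v) s := by
    refine le_antisymm (tableRank_le_of_eq hle hK) (Set.encard_le_encard fun t ht => ?_)
    simp only [Set.mem_ofPred_eq] at ht ⊢
    have := add_tableRank_lt_add_tableRank ht (by simp [hs])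
    rw [hK, hex v t (hs ▸ this.le)]
    exact ht
  rw [hx r hr, detectionMessage_eq (s := s), hK]
  · rw [hK]
    have htop : N.sourceTable S v s ≠ ⊤ := fun h => by simp [h] at hs
    obtain ⟨s, hsS, rfl⟩ := exists_of_sourceTable_ne_top htop
    rw [sourceTable_ident hsS]
    exact_mod_cast N.dist_lt_card s v
  · rw [hK, hrank, hs]

/-- A neighbour u one step nearer to s has a strictly smaller sum q < r, so by induction it
announced s correctly in round a + q, and v has heard it. -/
theorem IsDetection.knownTable_eq (hx : N.IsDetection S x a R) (r : ℕ) (hr : r ≤ R) (v : V) (s : ℕ)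
    (hs : N.sourceTable S v s + tableRank (N.sourceTable S v) s ≤ r) :
    N.knownTable S x a (a + r) (a + r) v s = N.sourceTable S v s := by
  induction r using Nat.strong_induction_on generalizing v s with
  | _ r ih =>
    refine le_antisymm ?_ ((hx.sourceTable_le r hr).2 v s)
    have htop : N.sourceTable S v s ≠ ⊤ := fun h => by simp [h] at hs
    obtain ⟨s, hsS, rfl⟩ := exists_of_sourceTable_ne_top htop
    by_cases hsv : s = v
    · subst hsv
      rw [sourceTable_ident hsS, SimpleGraph.dist_self]
      exact inf_le_left.trans (iInf_le _ ⟨hsS, rfl⟩)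
    obtain ⟨u, huv, hd⟩ := N.exists_adj_dist_add_one hsv
    have hrank := tableRank_sourceTable_le huv hsS hd
    have hlt : N.sourceTable S u (N.ident s) + tableRank (N.sourceTable S u) (N.ident s) + 1 ≤
        r := by
      refine le_trans ?_ hs
      rw [sourceTable_ident hsS, sourceTable_ident hsS, ← hd, add_right_comm]
      push_cast
      gcongr
    obtain ⟨q, hq⟩ := ENat.ne_top_iff_exists.1
      (show N.sourceTable S u (N.ident s) + tableRank (N.sourceTable S u) (N.ident s) ≠ ⊤ from
        fun h => by simp [h] at hlt)
    rw [← hq] at hlt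
    have hqr : q < r := by exact_mod_cast hlt
    have hsent := hx.sent_eq (hqr.trans_le hr) (fun v s => ih q hqr (by omega) v s) hq.symm
    refine (knownTable_le_heardTable_add_one le_rfl huv _).trans ?_
    rw [sourceTable_ident hsS, ← hd]
    rw [sourceTable_ident hsS, ENat.toNat_natCast] at hsent
    push_cast
    gcongr
    exact iInf_le_of_le (a + q) <| iInf_le_of_le _ <| iInf_le _ ⟨by omega, by omega, hsent⟩

/-- After enough rounds, the first `k` entries of all tables are correct, and all neighbours have
been told about them. -/
theorem IsDetection.approximatesTable (hx : N.IsDetection S x a R) {k D : ℕ}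
    (hD : ∀ u v, N.graph.dist u v ≤ D) (hR : D + k ≤ R) :
    (∀ v, ApproximatesTable k (N.knownTable S x a (a + R) (a + R) v) (N.sourceTable S v)) ∧
    ∀ u, ApproximatesTable k (heardTable a (a + R) (x · u)) (N.sourceTable S u) := by
  have hle := hx.sourceTable_le R le_rfl
  -- Distance at most D and position at most k - 1: such entries are due before round D + k.
  have hsum : ∀ v s, N.sourceTable S v s ≠ ⊤ → tableRank (N.sourceTable S v) s < k →
      ∃ q < R, N.sourceTable S v s + tableRank (N.sourceTable S v) s = (q : ℕ) := by
    intro v s htop hk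
    obtain ⟨s, hs, rfl⟩ := exists_of_sourceTable_ne_top htop
    obtain ⟨i, hi⟩ := ENat.ne_top_iff_exists.1 (ne_top_of_lt hk)
    rw [← hi] at hk ⊢
    rw [sourceTable_ident hs]
    have := hD s v
    have hk : i < k := by exact_mod_cast hk
    exact ⟨N.graph.dist s v + i, by omega, by norm_cast⟩
  refine ⟨fun v => ⟨hle.2 v, fun s hs => ?_⟩, fun u => ⟨hle.1 u, fun s hs => ?_⟩⟩
  · by_cases htop : N.sourceTable S v s = ⊤
    · exact le_antisymm (by simp [htop]) (hle.2 v s)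
    obtain ⟨q, hq, he⟩ := hsum v s htop hs
    exact hx.knownTable_eq R le_rfl v s (he ▸ by exact_mod_cast hq.le)
  · by_cases htop : N.sourceTable S u s = ⊤
    · exact le_antisymm (by simp [htop]) (hle.1 u s)
    obtain ⟨q, hq, he⟩ := hsum u s htop hs
    refine le_antisymm ?_ (hle.1 u s)
    have hsent := hx.sent_eq hq (fun v s => hx.knownTable_eq q hq.le v s) he
    refine iInf_le_of_le (a + q) <| iInf_le_of_le _ <|
      iInf_le_of_le ⟨by omega, by omega, hsent⟩ ?_
    rw [ENat.natCast_toNat htop]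

end Network

/-! ### The girth approximation algorithm -/

/-- The number of estimations that are run. -/
def scaleCount (f n : ℕ) : ℕ := if n ≤ f then 1 else f

/-- The number of closest sources used in each estimation that is run. -/
noncomputable def closestCount (f : ℕ) (c : ℝ) (n : ℕ) : ℕ :=
  if n ≤ f then n else sourceCount f c n

/-- The number of rounds of each source detection. -/
noncomputable def detectionRounds (κ f : ℕ) (c : ℝ) (I : LocalInput) : ℕ :=
  κ * I.diamApprox + closestCount f c I.size

/-- Whether a vertex is a source of the scale `i`. -/
def LocalInput.IsSource (E : ℕ → ℕ → Set (ℕ → Bool)) (I : LocalInput) (i : ℕ) : Prop :=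
  i = 0 ∨ I.coins ∈ E I.size i

/-- The own table of the scale `i` of a vertex that has received `h`, before round `t`. -/
noncomputable def scaleTable (κ f : ℕ) (c : ℝ) (E : ℕ → ℕ → Set (ℕ → Bool)) (I : LocalInput)
    (i t : ℕ) (h : ℕ → ℕ → ℕ) : ℕ → ℕ∞ :=
  ownTable I.degree (I.IsSource E i) I.ident fun j =>
    heardTable (i * detectionRounds κ f c I) t (h · j)

/-- The minimum of the local parts of the estimates of all scales. -/
noncomputable def scalesEstimate (κ f : ℕ) (c : ℝ) (E : ℕ → ℕ → Set (ℕ → Bool)) (I : LocalInput)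
    (h : ℕ → ℕ → ℕ) : ℕ∞ :=
  ⨅ i : Fin (scaleCount f I.size), localEstimate I.degree (closestCount f c I.size)
    (fun j => heardTable (i * detectionRounds κ f c I)
      (i * detectionRounds κ f c I + detectionRounds κ f c I) (h · j))
    (scaleTable κ f c E I i (i * detectionRounds κ f c I + detectionRounds κ f c I) h)

open Classical in
/-- The source detections of all scales are run one after another; then the minimum of the values
computed locally is flooded through the network. -/
noncomputable def girthAlgorithm (κ f : ℕ) (c : ℝ) (E : ℕ → ℕ → Set (ℕ → Bool)) :
    BroadcastAlgorithm where
  message I t h :=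
    if t < scaleCount f I.size * detectionRounds κ f c I then
      detectionMessage I.size (t % detectionRounds κ f c I)
        (scaleTable κ f c E I (t / detectionRounds κ f c I) t h)
    else
      floodMessage (2 * I.size) (floodValue (scalesEstimate κ f c E I h)
        (scaleCount f I.size * detectionRounds κ f c I) t I.degree h)
  rounds I := scaleCount f I.size * detectionRounds κ f c I + κ * I.diamApprox
  result I h := floodValue (scalesEstimate κ f c E I h)
    (scaleCount f I.size * detectionRounds κ f c I)
    (scaleCount f I.size * detectionRounds κ f c I + κ * I.diamApprox) I.degree h

/-- The number of rounds of the girth approximation algorithm. -/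
noncomputable def girthRounds (κ f : ℕ) (c : ℝ) (n Dapx : ℕ) : ℕ :=
  scaleCount f n * (κ * Dapx + closestCount f c n) + κ * Dapx

/-- The at most f detections and the flooding spend κ Dapx ≤ κ² D rounds each, which gives 2 κ². The
49 is 48 from 12 (c + 3) ≤ 48 c, plus 1 for rounding up. -/
theorem girthRounds_le {κ f n Dapx D : ℕ} {c : ℝ} (hf : 1 ≤ f) (hc : 1 ≤ c) (hn : 1 ≤ n)
    (hD : Dapx ≤ κ * D) :
    (girthRounds κ f c n Dapx : ℝ) ≤
      (2 * κ ^ 2 + 49 : ℕ) * (c * f * (n : ℝ) ^ (1 / (f : ℝ)) + f * D) *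
        (Real.logb 2 n + 1) ^ 1 := by
  have hn' : (1 : ℝ) ≤ n := by exact_mod_cast hn
  have hf' : (1 : ℝ) ≤ f := by exact_mod_cast hf
  have hlog : 0 ≤ Real.logb 2 n := Real.logb_nonneg one_lt_two hn'
  set l := Real.logb 2 n
  set q := (n : ℝ) ^ (1 / (f : ℝ)) with hq
  have hq1 : 1 ≤ q := Real.one_le_rpow hn' (by positivity)
  have hDκ : (κ : ℝ) * Dapx ≤ κ ^ 2 * D := by
    have : (Dapx : ℝ) ≤ κ * D := by exact_mod_cast hD
    nlinarith [(Nat.cast_nonneg κ : (0 : ℝ) ≤ κ)]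
  have hDκ0 : (0 : ℝ) ≤ κ ^ 2 * D := by positivity
  have hfc : (f : ℝ) ≤ c * f * q := by
    have : (f : ℝ) * 1 ≤ f * (c * q) := by
      gcongr
      exact one_le_mul_of_one_le_of_one_le hc hq1
    linarith
  have hscale : (scaleCount f n : ℝ) * closestCount f c n ≤ 49 * (c * f * q) * (l + 1) := by
    unfold scaleCount closestCount
    split_ifs with h
    · have : (n : ℝ) ≤ f := by exact_mod_cast h
      push_cast
      nlinarith
    · have hk : (sourceCount f c n : ℝ) ≤ 12 * (c + 3) * q * l + 1 :=
        (Nat.ceil_lt_add_one (by positivity)).le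
      have h1 : 12 * (c + 3) * q * l ≤ 48 * c * q * l := by
        have : 12 * (c + 3) ≤ 48 * c := by linarith
        gcongr
      have h2 : 1 ≤ c * q := one_le_mul_of_one_le_of_one_le hc hq1
      have h3 : 0 ≤ c * q * l := by positivity
      calc (f : ℝ) * sourceCount f c n ≤ f * (49 * (c * q) * (l + 1)) := by
            gcongr
            nlinarith
        _ = _ := by ring
  have hsf : (scaleCount f n : ℝ) ≤ f := by
    unfold scaleCount
    split_ifs
    · simpa using hf'
    · exact le_rfl
  have hsum : (girthRounds κ f c n Dapx : ℝ) ≤ 2 * κ ^ 2 * (f * D) + 49 * (c * f * q) * (l + 1) := by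
    unfold girthRounds
    push_cast
    have h1 : (scaleCount f n : ℝ) * (κ * Dapx) ≤ f * (κ ^ 2 * D) := by gcongr
    have h2 : (κ : ℝ) ^ 2 * D ≤ f * (κ ^ 2 * D) := le_mul_of_one_le_left hDκ0 hf'
    nlinarith
  refine hsum.trans ?_
  push_cast
  have h1 : 0 ≤ c * f * q := by positivity
  have h2 : (0 : ℝ) ≤ f * D := by positivity
  have h3 : (0 : ℝ) ≤ κ ^ 2 := by positivity
  rw [pow_one]
  have h4 : 0 ≤ 2 * (κ : ℝ) ^ 2 * (f * D) * l := by positivity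
  have h5 : 0 ≤ 2 * (κ : ℝ) ^ 2 * (c * f * q) * (l + 1) := by positivity
  have h6 : 0 ≤ 49 * (f * (D : ℝ)) * (l + 1) := by positivity
  nlinarith

section Correctness

variable {V : Type} [Fintype V]

theorem girthAlgorithm_correct {a₀ κ f : ℕ} {c : ℝ} {E : ℕ → ℕ → Set (ℕ → Bool)}
    (N : Network V) {Dapx : ℕ}
    (hid : ∀ v, Nat.size (N.ident v) ≤ a₀ * (Nat.log 2 (Fintype.card V) + 1))
    (hdiam : N.graph.diam ≤ κ * Dapx) (ω : V → ℕ → Bool) :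
    (∀ t v j, ((girthAlgorithm κ f c E).toCongest.message
      ((girthAlgorithm κ f c E).toCongest.stateAfter N Dapx ω t v) j).length ≤
        (2 * a₀ + 3) * (Nat.log 2 (Fintype.card V) + 1)) ∧
    ∃ M : ℕ∞,
      (∀ v, (girthAlgorithm κ f c E).toCongest.output
        ((girthAlgorithm κ f c E).toCongest.stateAfter N Dapx ω
          (girthRounds κ f c (Fintype.card V) Dapx) v) = some M) ∧
      IsMultiScaleEstimate N f c (fun i => {v | ω v ∈ E (Fintype.card V) i}) M := by
  set n := Fintype.card V with hn
  set k := closestCount f c n with hk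
  set R := κ * Dapx + k with hR
  set m := scaleCount f n with hm
  have hD : ∀ u v, N.graph.dist u v ≤ κ * Dapx := by
    have := N.connected.nonempty
    exact fun u v => (SimpleGraph.dist_le_diam
      (SimpleGraph.connected_iff_ediam_ne_top.1 N.connected)).trans hdiam
  obtain ⟨x, hx, hlen, hout⟩ := (girthAlgorithm κ f c E).exists_run N Dapx ω
    (T := girthRounds κ f c n Dapx) fun v => rfl
  let S : ℕ → Set V := fun i => {v | i = 0 ∨ ω v ∈ E n i}
  have hdet : ∀ i < m, N.IsDetection (S i) x (i * R) R := by
    intro i hi r hr v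
    have hlt : i * R + r < m * R := by
      have : (i + 1) * R ≤ m * R := Nat.mul_le_mul_right _ hi
      rw [add_mul, one_mul] at this
      omega
    have hdiv : (i * R + r) / R = i := by
      rw [mul_comm, Nat.mul_add_div (by omega), Nat.div_eq_of_lt hr, add_zero]
    have hmod : (i * R + r) % R = r := by
      rw [mul_comm, Nat.mul_add_mod, Nat.mod_eq_of_lt hr]
    rw [hx _ (hlt.trans_le (Nat.le_add_right _ _)) v]
    change (if i * R + r < m * R then detectionMessage n ((i * R + r) % R)
      (scaleTable κ f c E (N.localInput Dapx ω v) ((i * R + r) / R) (i * R + r) _) else _) = _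
    rw [if_pos hlt, hdiv, hmod]
    rfl
  have happ := fun i hi => (hdet i hi).approximatesTable (k := k) hD le_rfl
  let O : ℕ → V → ℕ → ℕ∞ := fun i v => N.knownTable (S i) x (i * R) (i * R + R) (i * R + R) v
  let L : ℕ → V → ℕ → ℕ → ℕ∞ := fun i v j =>
    heardTable (i * R) (i * R + R) (N.history x (i * R + R) v · j)
  have hO : ∀ i < m, ∀ v, ApproximatesTable k (O i v) (N.sourceTable (S i) v) :=
    fun i hi => (happ i hi).1
  have hL : ∀ i < m, ∀ v (j : Fin (N.deg v)),
      ApproximatesTable k (L i v j) (N.sourceTable (S i) (N.port v j)) := by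
    intro i hi v j
    have := (happ i hi).2 (N.port v j)
    rwa [← Network.heardTable_history le_rfl] at this
  -- Messages of the flooding phase lie outside the detection windows, so the local value no longer
  -- changes.
  have hlocal : ∀ t, m * R ≤ t → ∀ v, scalesEstimate κ f c E (N.localInput Dapx ω v)
      (N.history x t v) = ⨅ i : Fin m, localEstimate (N.deg v) k (L i v) (O i v) := by
    intro t ht v
    refine iInf_congr fun i => ?_
    have hi : i * R + R ≤ t := by
      have : ((i : ℕ) + 1) * R ≤ m * R := Nat.mul_le_mul_right _ i.2
      rw [add_mul, one_mul] at this
      omega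
    have h1 : scaleTable κ f c E (N.localInput Dapx ω v) i (i * R + R) (N.history x t v) =
        O i v := Network.knownTable_eq_of_le (S := S i) hi v
    have h2 : ∀ j < N.deg v, heardTable (i * R) (i * R + R) (N.history x t v · j) = L i v j :=
      fun j hj => (Network.heardTable_history hi v ⟨j, hj⟩).trans
        (Network.heardTable_history le_rfl v ⟨j, hj⟩).symm
    change localEstimate (N.deg v) k _ (scaleTable κ f c E _ i (i * R + R) _) = _
    rw [h1]
    exact localEstimate_congr h2
  set M₀ : V → ℕ∞ := fun v => ⨅ i : Fin m, localEstimate (N.deg v) k (L i v) (O i v) with hM₀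
  have hflood : N.IsFlooding M₀ (2 * n) x (m * R) (κ * Dapx) := by
    intro r hr v
    rw [hx (m * R + r) (Nat.add_lt_add_left hr _) v]
    change (if m * R + r < m * R then _ else floodMessage (2 * n)
      (floodValue (scalesEstimate κ f c E _ _) (m * R) (m * R + r) (N.deg v) _)) = _
    rw [if_neg (by omega), hlocal _ (by omega)]
  have hM₀le : ∀ v, M₀ v = ⊤ ∨ M₀ v ≤ (2 * n : ℕ) := by
    intro v
    rw [or_iff_not_imp_left]
    intro hne
    simp only [hM₀, iInf_eq_top, not_forall] at hne
    obtain ⟨i, hne⟩ := hne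
    exact (iInf_le _ i).trans
      ((Network.localEstimate_eq_top_or_le (hO i i.2) (hL i i.2) v).resolve_left hne)
  refine ⟨fun t v j => (hlen t v j).trans ?_, ⨅ v, M₀ v, fun v => ?_, ?_⟩
  · have hnl : n < 2 ^ (Nat.log 2 n + 1) := Nat.lt_pow_succ_log_self one_lt_two n
    split_ifs with ht
    swap
    · exact Nat.zero_le _
    rcases lt_or_ge t (m * R) with htm | htm
    · have hR0 : 0 < R := Nat.pos_of_mul_pos_left (by omega : 0 < m * R)
      have hi : t / R < m := Nat.div_lt_of_lt_mul (by rwa [mul_comm])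
      have he : t / R * R + t % R = t := Nat.div_add_mod' t R
      have := (hdet _ hi).size_le (Nat.mod_lt t hR0) hid v
      rwa [he] at this
    · obtain ⟨r, rfl⟩ := Nat.exists_eq_add_of_le htm
      rw [hflood r (Nat.lt_of_add_lt_add_left ht) v, Nat.size_le]
      refine (floodMessage_le _ _).trans_lt ?_
      -- A flooded number is at most 2n + 1, which is less than 2 · 2^{⌊log₂ n⌋ + 1}.
      have : 2 ^ (Nat.log 2 n + 1 + 1) ≤ 2 ^ ((2 * a₀ + 3) * (Nat.log 2 n + 1)) :=
        Nat.pow_le_pow_right two_pos (by nlinarith [Nat.zero_le (Nat.log 2 n * a₀)])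
      rw [pow_succ] at this
      omega
  · rw [hout v]
    change some (floodValue (scalesEstimate κ f c E _ (N.history x (m * R + κ * Dapx) v)) (m * R)
      (m * R + κ * Dapx) (N.deg v)
      (N.history x (m * R + κ * Dapx) v)) = _
    rw [hlocal _ (Nat.le_add_right _ _)]
    exact congrArg some (hflood.floodValue_eq hM₀le hD v)
  · have hest : ∀ i < m, N.IsEstimate (S i) k
        (⨅ v, localEstimate (N.deg v) k (L i v) (O i v)) := fun i hi =>
      Network.isEstimate_iInf_localEstimate (hO i hi) (hL i hi)
    -- After exchanging the minima, the inner one over all vertices is the estimate of a single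
    -- scale.
    rw [hM₀, iInf_comm]
    unfold IsMultiScaleEstimate
    split_ifs with h
    · have hm1 : m = 1 := if_pos h
      have hS : S 0 = Set.univ := by simp [S]
      have hk1 : k = n := if_pos h
      rw [hm1, ciInf_unique, ← hS, ← hn, ← hk1]
      exact hest 0 (by omega)
    · have hm1 : m = f := if_neg h
      have hk1 : k = sourceCount f c n := if_neg h
      rw [hm1]
      refine ⟨_, fun i => ?_, rfl⟩
      have hS : (if (i : ℕ) = 0 then Set.univ else {v | ω v ∈ E n i}) = S i := by
        split_ifs with hi <;> simp [S, hi]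
      change N.IsEstimate (if (i : ℕ) = 0 then Set.univ else {v | ω v ∈ E n i})
        (sourceCount f c n) _
      rw [hS, ← hk1]
      exact hest i (by omega)

end Correctness

/-- Fix constants `a₀` (identifiers have `O(log n)` bits) and `κ` (quality of the known diameter
approximation). There are constants `β`, `C`, `e` such that for all `f ≥ 1` and `c ≥ 1` some
randomized CONGEST algorithm, with messages of at most `β (⌊log₂ n⌋ + 1)` bits, always terminates
within `C (c f n^{1/f} + f D) (log₂ n + 1)^e` rounds with a common value `M` at all vertices, which
is the minimum of the estimates at the `f` sampling scales, and `g ≤ M ≤ f g` fails with probability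
at most `n^{-c}`. -/
theorem mainTheorem1 (a₀ κ : ℕ) :
    ∃ (β : ℕ) (C : ℝ) (e : ℕ), ∀ (f : ℕ) (c : ℝ), 1 ≤ f → 1 ≤ c →
      ∃ (A : CongestAlgorithm) (E : ℕ → ℕ → Set (ℕ → Bool)),
        (∀ n, IsSampling f c n (E n)) ∧
        ∀ (V : Type) [Fintype V] (N : Network V) (Dapx : ℕ),
          (∀ v, Nat.size (N.ident v) ≤ a₀ * (Nat.log 2 (Fintype.card V) + 1)) →
          N.graph.diam ≤ κ * Dapx → Dapx ≤ κ * N.graph.diam →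
          -- every message has `O(log n)` bits
          (∀ (ω : V → ℕ → Bool) (t : ℕ) (v : V) (j : ℕ), j < N.deg v →
            (A.message (A.stateAfter N Dapx ω t v) j).length
              ≤ β * (Nat.log 2 (Fintype.card V) + 1)) ∧
          ∃ (T : ℕ) (M : (V → ℕ → Bool) → ℕ∞),
            -- the number of rounds
            (T : ℝ) ≤ C * (c * f * (Fintype.card V : ℝ) ^ (1 / (f : ℝ)) + f * N.graph.diam)
                * (Real.logb 2 (Fintype.card V) + 1) ^ e ∧
            -- every vertex has terminated with result `M ω`
            (∀ (ω : V → ℕ → Bool) (v : V),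
              A.output (A.stateAfter N Dapx ω T v) = some (M ω)) ∧
            -- the value that is computed
            (∀ ω : V → ℕ → Bool, IsMultiScaleEstimate N f c
              (fun i => {v | ω v ∈ E (Fintype.card V) i}) (M ω)) ∧
            -- the approximation guarantee holds with probability at least `1 - n^{-c}`
            networkCoinLaw V {ω | ¬ (N.graph.egirth ≤ M ω ∧ M ω ≤ (f : ℕ∞) * N.graph.egirth)}
              ≤ ENNReal.ofReal ((Fintype.card V : ℝ) ^ (-c)) := by
  refine ⟨2 * a₀ + 3, (2 * κ ^ 2 + 49 : ℕ), 1, fun f c hf hc => ?_⟩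
  choose E hE using fun n => exists_isSampling f (by linarith : 0 ≤ c + 3) n
  refine ⟨(girthAlgorithm κ f c E).toCongest, E, hE, fun V _ N Dapx hid hdiam hDapx => ?_⟩
  have hcorrect := girthAlgorithm_correct (f := f) (c := c) (E := E) N hid hdiam
  choose hlen M hout hM using hcorrect
  refine ⟨fun ω t v j _ => hlen ω t v j, girthRounds κ f c (Fintype.card V) Dapx, M,
    girthRounds_le hf hc (Fintype.card_pos_iff.2 N.connected.nonempty) hDapx, hout, hM,
    measure_not_approx_le N hf hc (hE _) hM⟩
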